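/- **Definitions.** A *triangulated disc* is a finite simplicial complex $D$ homeomorphic to the closed disc in the plane. A *polyhedral disc* is a map $F\colon D\to\mathbb R^3$, where $D$ is a triangulated disc and $F$ is linear on every triangle of $D$ (self-intersections and degenerate image triangles are allowed). Its *area* is the sum of the areas of the images of all triangles of $D$. Two polyhedral discs $F\colon D\to\mathbb R^3$ and $G\colon D'\to\mathbb R^3$ have the same boundary curve if $F|_{\partial D}=G|_{\partial D'}\circ\varphi$ for some homeomorphism $\varphi\colon\partial D\to\partial D'$. For a given positive integer $n$, a polyhedral disc $F$ is *area minimizing* if it has at most $n$ triangles and has the least area among all polyhedral discs (on arbitrary triangulated discs) with the same boundary curve as $F$ and at most $n$ triangles. A vertex is *interior* if it does not lie on $\partial D$. A plane *cuts* an edge $[ab]$ if $F(a)$ and $F(b)$ lie strictly on opposite sides of it. $F$ is *saddle at* an interior vertex $a$ if no plane cuts all the edges coming from $a$, and $F$ is *saddle* if it is saddle at every interior vertex. **Theorem.** Let $n$ be a positive integer and let $F$ be an area minimizing polyhedral disc for $n$. Then $F$ is saddle at every interior vertex $a$ for which at least one triangle of $D$ containing $a$ has a nondegenerate image (an image not contained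 in a line). In particular, if $F$ maps every triangle of $D$ to a nondegenerate triangle, then $F$ is saddle. -/

import Mathlib

/-- Euclidean 3-space. -/
abbrev Space3 : Type := EuclideanSpace ℝ (Fin 3)

/-- A finite, purely 2-dimensional abstract simplicial complex, given by its set of triangles.
Its edges and vertices are the faces of its triangles. -/
structure TriComplex (V : Type) where
  triangles : Finset (Finset V)
  card_eq_three : ∀ t ∈ triangles, t.card = 3

namespace TriComplex

variable {V : Type} (K : TriComplex V)

def vertices : Set V := {v | ∃ t ∈ K.triangles, v ∈ t}

def edges : Set (Finset V) := {e | e.card = 2 ∧ ∃ t ∈ K.triangles, e ⊆ t}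

/-- The triangles of `K` that have `e` as a face. -/
def trianglesOn (e : Finset V) : Set (Finset V) := {t | t ∈ K.triangles ∧ e ⊆ t}

/-- The edges that lie in exactly one triangle. -/
def boundaryEdges : Set (Finset V) := {e | e ∈ K.edges ∧ (K.trianglesOn e).ncard = 1}

/-- The vertices that do not lie on the boundary. -/
def interiorVertices : Set V := {v | v ∈ K.vertices ∧ ∀ e ∈ K.boundaryEdges, v ∉ e}

/-- The 1-skeleton: `x` and `y` are adjacent if they are joined by an edge of `K`. -/
def graph : SimpleGraph V where
  Adj x y := x ≠ y ∧ ∃ t ∈ K.triangles, x ∈ t ∧ y ∈ t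
  symm := ⟨fun _ _ h => ⟨h.1.symm, h.2.imp fun _ ht => ⟨ht.1, ht.2.2, ht.2.1⟩⟩⟩
  loopless := ⟨fun _ h => h.1 rfl⟩

/-- The link of `v`: `x` and `y` are adjacent if `v`, `x`, `y` span a triangle of `K`. -/
def link (v : V) : SimpleGraph V where
  Adj x y := x ≠ y ∧ x ≠ v ∧ y ≠ v ∧ ∃ t ∈ K.triangles, v ∈ t ∧ x ∈ t ∧ y ∈ t
  symm := ⟨fun _ _ h =>
    ⟨h.1.symm, h.2.2.1, h.2.1, h.2.2.2.imp fun _ ht => ⟨ht.1, ht.2.1, ht.2.2.2, ht.2.2.1⟩⟩⟩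
  loopless := ⟨fun _ h => h.1 rfl⟩

/-- `K` is a triangulated disc: a connected triangulated surface (every edge lies in at most two
triangles and the link of every vertex is connected, hence is a path or a cycle), with nonempty
boundary and Euler characteristic `1`. By the classification of compact surfaces these are
exactly the simplicial complexes that are homeomorphic to the closed disc. -/
structure IsDisc : Prop where
  edge_le_two : ∀ e ∈ K.edges, (K.trianglesOn e).ncard ≤ 2
  link_connected : ∀ v ∈ K.vertices, ∀ x y : V,
    K.graph.Adj v x → K.graph.Adj v y → (K.link v).Reachable x y
  connected : ∀ x ∈ K.vertices, ∀ y ∈ K.vertices, K.graph.Reachable x y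
  boundary_nonempty : K.boundaryEdges.Nonempty
  euler_char : (K.vertices.ncard : ℤ) - K.edges.ncard + K.triangles.card = 1

/-- The geometric realization of the boundary, in barycentric coordinates. -/
def boundaryRealization : Set (V → ℝ) :=
  {w | ∃ e ∈ K.boundaryEdges, (∀ v, 0 ≤ w v) ∧ (∀ v, v ∉ e → w v = 0) ∧ ∑ v ∈ e, w v = 1}

end TriComplex

/-- The area of the (possibly degenerate) triangle `p q r`. -/
noncomputable def triangleArea (p q r : Space3) : ℝ :=
  1 / 2 * dist p q * dist p r * Real.sin (EuclideanGeometry.angle q p r)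

/-- A polyhedral disc: a triangulated disc together with a map to space that is linear on every
triangle. Such a map is given by the positions of the vertices (the values of `pos` at labels
that are not vertices play no role). -/
structure PolyhedralDisc (V : Type) where
  complex : TriComplex V
  isDisc : complex.IsDisc
  pos : V → Space3

namespace PolyhedralDisc

variable {V W : Type}

/-- The piecewise linear map in barycentric coordinates. -/
noncomputable def toMap (F : PolyhedralDisc V) (w : V → ℝ) : Space3 := ∑ᶠ v, w v • F.pos v

/-- The area of the image of the triangle `t`. The sum over all ordered triples of vertices counts
every triangle six times; see `faceArea_eq`. -/
noncomputable def faceArea (F : PolyhedralDisc V) (t : Finset V) : ℝ :=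
  1 / 6 * ∑ a ∈ t, ∑ b ∈ t, ∑ c ∈ t, triangleArea (F.pos a) (F.pos b) (F.pos c)

/-- The area: the sum of the areas of all triangles. -/
noncomputable def area (F : PolyhedralDisc V) : ℝ := ∑ t ∈ F.complex.triangles, F.faceArea t

/-- `F` and `G` have the same boundary curve, up to a reparametrization. -/
def SameBoundary (F : PolyhedralDisc V) (G : PolyhedralDisc W) : Prop :=
  ∃ φ : F.complex.boundaryRealization ≃ₜ G.complex.boundaryRealization,
    ∀ w, G.toMap (φ w) = F.toMap w

/-- `F` has at most `n` triangles, and it has the least area among all polyhedral discs with the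
same boundary curve and at most `n` triangles. -/
def IsAreaMinimizing (n : ℕ) (F : PolyhedralDisc V) : Prop :=
  F.complex.triangles.card ≤ n ∧
    ∀ (W : Type) (G : PolyhedralDisc W), F.SameBoundary G → G.complex.triangles.card ≤ n →
      F.area ≤ G.area

/-- No plane `{x | ⟪u, x⟫ = c}` has the endpoints of every edge coming from `a` strictly on
opposite sides. -/
def IsSaddleAt (F : PolyhedralDisc V) (a : V) : Prop :=
  ¬ ∃ (u : Space3) (c : ℝ), u ≠ 0 ∧ ∀ b, F.complex.graph.Adj a b →
    (inner ℝ u (F.pos a) - c) * (inner ℝ u (F.pos b) - c) < 0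

/-- The image of the triangle `t` is not contained in a line. -/
def NondegenerateOn (F : PolyhedralDisc V) (t : Finset V) : Prop :=
  ¬ Collinear ℝ (F.pos '' (t : Set V))

end PolyhedralDisc

theorem triangleArea_eq (p q r : Space3) : triangleArea p q r =
    1 / 2 * Real.sqrt (inner ℝ (q - p) (q - p) * inner ℝ (r - p) (r - p)
      - inner ℝ (q - p) (r - p) * inner ℝ (q - p) (r - p)) := by
  have h := InnerProductGeometry.sin_angle_mul_norm_mul_norm (q - p) (r - p)
  rw [← h, triangleArea, EuclideanGeometry.angle, dist_eq_norm', dist_eq_norm']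
  simp only [vsub_eq_sub]
  ring

theorem triangleArea_swap (p q r : Space3) : triangleArea p q r = triangleArea p r q := by
  simp only [triangleArea, EuclideanGeometry.angle_comm q p r]
  ring

theorem triangleArea_rotate (p q r : Space3) : triangleArea p q r = triangleArea q p r := by
  rw [triangleArea_eq, triangleArea_eq]
  congr 2
  have h1 : p - q = -(q - p) := by abel
  have h2 : r - q = (r - p) - (q - p) := by abel
  rw [h1, h2]
  generalize q - p = x
  generalize r - p = y
  simp only [inner_sub_left, inner_sub_right, inner_neg_left, inner_neg_right,
    real_inner_comm x y]
  ring

theorem triangleArea_self_left (p q : Space3) : triangleArea p p q = 0 := by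
  simp [triangleArea]

theorem PolyhedralDisc.faceArea_eq {V : Type} [DecidableEq V] (F : PolyhedralDisc V) {a b c : V}
    (hab : a ≠ b) (hac : a ≠ c) (hbc : b ≠ c) :
    F.faceArea {a, b, c} = triangleArea (F.pos a) (F.pos b) (F.pos c) := by
  have z1 := triangleArea_self_left
  have z2 : ∀ p q : Space3, triangleArea p q p = 0 := fun p q => by
    rw [triangleArea_swap, z1]
  have z3 : ∀ p q : Space3, triangleArea p q q = 0 := fun p q => by
    rw [triangleArea_rotate, z2]
  rw [PolyhedralDisc.faceArea]
  have hs : ∀ f : V → ℝ, ∑ x ∈ ({a, b, c} : Finset V), f x = f a + f b + f c := fun f => by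
    rw [Finset.sum_insert (by simp [hab, hac]), Finset.sum_insert (by simp [hbc]),
      Finset.sum_singleton, add_assoc]
  simp only [hs, z1, z2, z3]
  generalize F.pos a = p
  generalize F.pos b = q
  generalize F.pos c = r
  rw [triangleArea_swap p r q, triangleArea_rotate q p r, triangleArea_swap q r p,
    triangleArea_rotate q p r, triangleArea_rotate r p q, triangleArea_swap p r q,
    triangleArea_rotate r q p, triangleArea_swap q r p, triangleArea_rotate q p r]
  ring

/-! The proof is an infinite descent on the number of triangles at a vertex `a`. If some plane cuts
all edges at `a`, then a vector `u` has positive inner product with every edge vector from `a`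
(`NonSaddle`). From such a minimizing disc one builds another, also non-saddle at `a`, with fewer
triangles at `a`.

The descent step flips an edge `a y` shared by `a x y` and `a y z`, putting `a x z` and `x y z` in
their place. An edge whose flip does not increase area is found as follows. If all triangles at `a`
are nondegenerate, the area is differentiable in the position of `a`, and minimality makes its
derivative along `u` vanish. By the cotangent formula, the sum over the edges `a y` of `⟪u, y - a⟫
(cot ξ + cot ζ)` is zero, where `ξ` and `ζ` are the angles at `x` and `z` opposite to `a y`. All
weights are positive, so some edge has `cot ξ + cot ζ ≤ 0`, that is `ξ + ζ ≥ π`. For such an edge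
`parArea_flip_le` shows that flipping does not increase area, in any dihedral position. If instead a
triangle at `a` is degenerate, its other two vertices lie on one ray from `a`, and flipping the edge
to the farther one preserves the area.

If `x` and `z` are not adjacent, the flip is again a disc with the same boundary and as many
triangles, hence minimizing, and `a` has lost a triangle. If they are adjacent, the flipped complex
is not simplicial. But every closed edge path of length three in a disc bounds a chain of triangles
modulo 2 (`IsDisc.exists_fills`), and a chain bounded by `a x z` or by `x y z` contains both old
triangles. Replacing that chain by the single triangle (`collapse`) gives a disc with no more
triangles. For `a x z` this is the desired smaller star; for `x y z` it would swallow the whole star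
of `a` and contradict minimality.

A triangle of positive area at `a` must survive each step, since a star of zero area gives no
contradiction. This is why the equality case of the flip inequality is tracked.

That the modified complexes are discs is checked homologically: for a connected surface with
nonempty boundary, Euler characteristic 1 means vanishing first homology modulo 2
(`IsBorderedSurface.euler_char_iff`). -/

/-! ### Graphs and small finite sets -/

theorem SimpleGraph.Reachable.induct {V : Type} {G : SimpleGraph V} {P : V → Prop}
    (h : ∀ x y, G.Adj x y → P x → P y) {x y : V} (hxy : G.Reachable x y) (hx : P x) : P y := by
  obtain ⟨p⟩ := hxy
  induction p with
  | nil => exact hx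
  | cons e _ ih => exact ih (h _ _ e hx)

/-- An edge may go to a path or to a point, so `f` need not be a graph homomorphism; retractions
onto a modified complex are of this kind. -/
theorem SimpleGraph.Reachable.map_of_adj {V : Type} {G G' : SimpleGraph V} (f : V → V)
    (h : ∀ x y, G.Adj x y → G'.Reachable (f x) (f y)) {x y : V} (hxy : G.Reachable x y) :
    G'.Reachable (f x) (f y) :=
  hxy.induct (P := fun y => G'.Reachable (f x) (f y)) (fun _ _ e hx => hx.trans (h _ _ e)) .rfl

theorem Finset.exists_eq_of_card_eq_three {V : Type} [DecidableEq V] {t : Finset V}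
    (ht : t.card = 3) {v w : V} (hv : v ∈ t) (hw : w ∈ t) (hvw : v ≠ w) :
    ∃ x, x ≠ v ∧ x ≠ w ∧ t = {v, w, x} := by
  have h1 : ((t.erase v).erase w).card = 1 := by
    rw [card_erase_of_mem (by simp [hw, hvw.symm]), card_erase_of_mem hv, ht]
  obtain ⟨x, hx⟩ := card_eq_one.1 h1
  have hx' : x ∈ (t.erase v).erase w := by simp [hx]
  simp only [mem_erase] at hx'
  refine ⟨x, hx'.2.1, hx'.1, ?_⟩
  rw [← insert_erase hv, ← insert_erase (show w ∈ t.erase v by simp [hw, hvw.symm]), hx]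

theorem Finset.exists_eq_of_card_eq_two {V : Type} [DecidableEq V] {e : Finset V}
    (he : e.card = 2) {v : V} (hv : v ∈ e) : ∃ w, w ≠ v ∧ e = {v, w} := by
  obtain ⟨x, y, hxy, rfl⟩ := card_eq_two.1 he
  rcases mem_insert.1 hv with rfl | h
  · exact ⟨y, hxy.symm, rfl⟩
  · rw [mem_singleton] at h
    subst h
    exact ⟨x, hxy, pair_comm _ _⟩

/-! ### Chains modulo 2 on a surface with boundary -/

namespace TriComplex

/-- A connected triangulated surface with nonempty boundary, without any condition on the Euler
characteristic. -/
structure IsBorderedSurface {V : Type} (K : TriComplex V) : Prop where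
  edge_le_two : ∀ e ∈ K.edges, (K.trianglesOn e).ncard ≤ 2
  link_connected : ∀ v ∈ K.vertices, ∀ x y : V,
    K.graph.Adj v x → K.graph.Adj v y → (K.link v).Reachable x y
  connected : ∀ x ∈ K.vertices, ∀ y ∈ K.vertices, K.graph.Reachable x y
  boundary_nonempty : K.boundaryEdges.Nonempty

theorem IsDisc.isBorderedSurface {V : Type} {K : TriComplex V} (h : K.IsDisc) :
    K.IsBorderedSurface :=
  ⟨h.edge_le_two, h.link_connected, h.connected, h.boundary_nonempty⟩

section

variable {V : Type} [DecidableEq V] {K : TriComplex V}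

theorem pair_mem_edges {v w : V} : {v, w} ∈ K.edges ↔ K.graph.Adj v w := by
  simp only [edges, graph, Set.mem_ofPred_eq, Finset.insert_subset_iff,
    Finset.singleton_subset_iff]
  refine and_congr_left fun _ => ⟨fun h => ?_, fun h => Finset.card_pair h⟩
  rintro rfl
  simp at h

omit [DecidableEq V] in
theorem mem_vertices_of_adj {v w : V} (h : K.graph.Adj v w) : v ∈ K.vertices :=
  h.2.imp fun _ ht => ⟨ht.1, ht.2.1⟩

omit [DecidableEq V] in
theorem exists_adj_of_mem {t : Finset V} (ht : t ∈ K.triangles) {v : V} (hv : v ∈ t) :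
    ∃ w ∈ t, K.graph.Adj v w := by
  obtain ⟨w, hw, hne⟩ := Finset.exists_mem_ne (s := t) (by rw [K.card_eq_three t ht]; norm_num) v
  exact ⟨w, hw, hne.symm, t, ht, hv, hw⟩

variable (K)

/-- The edges of `K` as a finset. -/
def edgeFinset : Finset (Finset V) := K.triangles.biUnion (Finset.powersetCard 2)

/-- The vertices of `K` as a finset. -/
def vertexFinset : Finset V := K.triangles.biUnion id

/-- The triangles of `K` on the edge `e` as a finset. -/
def triOn (e : Finset V) : Finset (Finset V) := {t ∈ K.triangles | e ⊆ t}

/-- The boundary map modulo `2` from `2`-chains to `1`-chains. -/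
def bd (c : Finset V → ZMod 2) (e : Finset V) : ZMod 2 := ∑ t ∈ K.triOn e, c t

/-- The boundary map modulo `2` from `1`-chains to `0`-chains. -/
def vbd (z : Finset V → ZMod 2) (v : V) : ZMod 2 := ∑ e ∈ K.edgeFinset with v ∈ e, z e

variable {K}

theorem mem_edgeFinset {e : Finset V} : e ∈ K.edgeFinset ↔ e ∈ K.edges := by
  simp only [edgeFinset, edges, Finset.mem_biUnion, Finset.mem_powersetCard, Set.mem_ofPred_eq]
  exact ⟨fun ⟨t, ht, h1, h2⟩ => ⟨h2, t, ht, h1⟩, fun ⟨h2, t, ht, h1⟩ => ⟨t, ht, h1, h2⟩⟩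

theorem mem_vertexFinset {v : V} : v ∈ K.vertexFinset ↔ v ∈ K.vertices := by
  simp [vertexFinset, vertices]

theorem mem_triOn {e t : Finset V} : t ∈ K.triOn e ↔ t ∈ K.triangles ∧ e ⊆ t := by
  simp [triOn]

theorem ncard_trianglesOn (e : Finset V) : (K.trianglesOn e).ncard = (K.triOn e).card := by
  rw [← Set.ncard_coe_finset]
  congr 1
  ext t
  simp [trianglesOn, mem_triOn]

theorem ncard_edges : K.edges.ncard = K.edgeFinset.card := by
  rw [← Set.ncard_coe_finset]
  congr 1
  ext t
  simp [mem_edgeFinset]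

theorem ncard_vertices : K.vertices.ncard = K.vertexFinset.card := by
  rw [← Set.ncard_coe_finset]
  congr 1
  ext t
  simp [mem_vertexFinset]

theorem triOn_eq_pair {e t₁ t₂ : Finset V} (h2 : (K.triOn e).card ≤ 2) (h₁ : t₁ ∈ K.triOn e)
    (h₂ : t₂ ∈ K.triOn e) (hne : t₁ ≠ t₂) : K.triOn e = {t₁, t₂} := by
  symm
  apply Finset.eq_of_subset_of_card_le
  · simp [Finset.insert_subset_iff, h₁, h₂]
  · rw [Finset.card_pair hne]
    exact h2

theorem eq_of_bd_eq_zero {e : Finset V} (h2 : (K.triOn e).card ≤ 2) {c : Finset V → ZMod 2}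
    (hc : K.bd c e = 0) {t₁ t₂ : Finset V} (h₁ : t₁ ∈ K.triOn e) (h₂ : t₂ ∈ K.triOn e) :
    c t₁ = c t₂ := by
  by_cases hne : t₁ = t₂
  · rw [hne]
  · rw [bd, triOn_eq_pair h2 h₁ h₂ hne, Finset.sum_pair hne] at hc
    rw [CharTwo.add_eq_zero] at hc
    exact hc

/-- Consecutive vertices along a path in the link give triangles at `v` that share an edge at `v`,
so the value of `c` is carried from any triangle of the star to any other. -/
theorem eq_of_link_connected {v : V}
    (hl : ∀ x y : V, K.graph.Adj v x → K.graph.Adj v y → (K.link v).Reachable x y)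
    {α : Type} {c : Finset V → α}
    (hc : ∀ w, K.graph.Adj v w → ∀ t₁ ∈ K.triOn {v, w}, ∀ t₂ ∈ K.triOn {v, w}, c t₁ = c t₂)
    {t₁ t₂ : Finset V} (h₁ : t₁ ∈ K.triangles) (h₂ : t₂ ∈ K.triangles) (hv₁ : v ∈ t₁)
    (hv₂ : v ∈ t₂) : c t₁ = c t₂ := by
  obtain ⟨x, hx, hax⟩ := exists_adj_of_mem h₁ hv₁
  obtain ⟨y, hy, hay⟩ := exists_adj_of_mem h₂ hv₂
  have key : ∀ t ∈ K.triOn {v, y}, c t₁ = c t := by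
    refine (hl x y hax hay).induct (P := fun y => ∀ t ∈ K.triOn {v, y}, c t₁ = c t) ?_ ?_
    · rintro p q ⟨hpq, hpv, hqv, t, ht, hvt, hpt, hqt⟩ ih s hs
      rw [ih t (by simp [mem_triOn, Finset.insert_subset_iff, *])]
      exact hc q ⟨hqv.symm, t, ht, hvt, hqt⟩ t
        (by simp [mem_triOn, Finset.insert_subset_iff, *]) s hs
    · exact hc x hax t₁ (by simp [mem_triOn, Finset.insert_subset_iff, *])
  exact key t₂ (by simp [mem_triOn, Finset.insert_subset_iff, *])

theorem eq_of_bd_eq_zero_at {v : V} (h2 : ∀ e ∈ K.edges, (K.trianglesOn e).ncard ≤ 2)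
    (hl : ∀ x y : V, K.graph.Adj v x → K.graph.Adj v y → (K.link v).Reachable x y)
    {c : Finset V → ZMod 2} (hc : ∀ e ∈ K.edges, v ∈ e → K.bd c e = 0)
    {t₁ t₂ : Finset V} (h₁ : t₁ ∈ K.triangles) (h₂ : t₂ ∈ K.triangles) (hv₁ : v ∈ t₁)
    (hv₂ : v ∈ t₂) : c t₁ = c t₂ := by
  refine eq_of_link_connected hl (fun w hw s₁ hs₁ s₂ hs₂ => ?_) h₁ h₂ hv₁ hv₂
  have he := pair_mem_edges.2 hw
  exact eq_of_bd_eq_zero (ncard_trianglesOn (K := K) _ ▸ h2 _ he) (hc _ he (by simp)) hs₁ hs₂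

/-- There is no nonzero closed `2`-chain. -/
theorem IsBorderedSurface.eq_zero_of_bd_eq_zero (h : K.IsBorderedSurface)
    {c : Finset V → ZMod 2} (hc : ∀ e ∈ K.edges, K.bd c e = 0) :
    ∀ t ∈ K.triangles, c t = 0 := by
  intro t ht
  have loc : ∀ v ∈ K.vertices, ∀ t₁ ∈ K.triangles, ∀ t₂ ∈ K.triangles, v ∈ t₁ → v ∈ t₂ →
      c t₁ = c t₂ := fun v hv t₁ h₁ t₂ h₂ => eq_of_bd_eq_zero_at h.edge_le_two
    (h.link_connected v hv) (fun e he _ => hc e he) h₁ h₂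
  obtain ⟨e, he, he1⟩ := h.boundary_nonempty
  have hbe := hc e he
  rw [ncard_trianglesOn, Finset.card_eq_one] at he1
  obtain ⟨s, hs⟩ := he1
  -- A boundary edge lies in the single triangle `s`, so closedness forces `c s = 0`; local
  -- constancy around vertices then spreads the value over the connected surface.
  rw [bd, hs, Finset.sum_singleton] at hbe
  have hs' : s ∈ K.triangles := (mem_triOn.1 (hs ▸ Finset.mem_singleton_self s)).1
  obtain ⟨x, hx⟩ := Finset.card_pos.1 (by rw [K.card_eq_three s hs']; norm_num : 0 < s.card)
  obtain ⟨y, hy⟩ := Finset.card_pos.1 (by rw [K.card_eq_three t ht]; norm_num : 0 < t.card)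
  have key : ∀ t' ∈ K.triangles, y ∈ t' → c t' = 0 := by
    refine (h.connected x ⟨s, hs', hx⟩ y ⟨t, ht, hy⟩).induct
      (P := fun y => ∀ t' ∈ K.triangles, y ∈ t' → c t' = 0) ?_ ?_
    · rintro p q ⟨_, r, hr, hpr, hqr⟩ ih t' ht' hqt'
      rw [loc q ⟨r, hr, hqr⟩ t' ht' r hr hqt' hqr]
      exact ih r hr hpr
    · intro t' ht' hxt'
      rw [loc x ⟨s, hs', hx⟩ t' ht' s hs' hxt' hx, hbe]
  exact key t ht hy

/-- A vertex of a triangle lies on exactly two of its edges; this is the reason for `∂∂ = 0`. -/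
theorem sum_powersetCard_two_eq_zero {t : Finset V} (ht : t.card = 3) (v : V) :
    ∑ e ∈ Finset.powersetCard 2 t with v ∈ e, (1 : ZMod 2) = 0 := by
  by_cases hv : v ∈ t
  · have h1 : (Finset.powersetCard 2 t).filter (v ∈ ·) = (t.erase v).image (fun w => {v, w}) := by
      ext e
      simp only [Finset.mem_filter, Finset.mem_powersetCard, Finset.mem_image, Finset.mem_erase]
      constructor
      · rintro ⟨⟨h1, h2⟩, h3⟩
        obtain ⟨w, hw, rfl⟩ := Finset.exists_eq_of_card_eq_two h2 h3
        exact ⟨w, ⟨hw, h1 (by simp)⟩, rfl⟩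
      · rintro ⟨w, ⟨hw, hwt⟩, rfl⟩
        exact ⟨⟨by simp [Finset.insert_subset_iff, *], Finset.card_pair hw.symm⟩, by simp⟩
    rw [h1, Finset.sum_const, Finset.card_image_of_injOn, Finset.card_erase_of_mem hv, ht]
    · decide
    · intro a ha b hb hab
      simp only [Finset.coe_erase, Set.mem_sdiff, Set.mem_singleton_iff] at ha hb
      have : a ∈ ({v, b} : Finset V) := by
        rw [← show ({v, a} : Finset V) = {v, b} from hab]
        simp
      simpa [ha.2] using this
  · apply Finset.sum_eq_zero
    intro e he
    simp only [Finset.mem_filter, Finset.mem_powersetCard] at he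
    exact absurd (he.1.1 he.2) hv

theorem vbd_bd (c : Finset V → ZMod 2) (v : V) : K.vbd (K.bd c) v = 0 := by
  simp only [vbd, bd, triOn, Finset.sum_filter]
  have h1 : ∀ e ∈ K.edgeFinset, (if v ∈ e then ∑ t ∈ K.triangles, if e ⊆ t then c t else 0 else 0)
      = ∑ t ∈ K.triangles, if e ⊆ t then (if v ∈ e then c t else 0) else 0 := by
    intro e _
    split_ifs <;> simp
  rw [Finset.sum_congr rfl h1, Finset.sum_comm]
  apply Finset.sum_eq_zero
  intro t ht
  have h3 := sum_powersetCard_two_eq_zero (K.card_eq_three t ht) v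
  rw [← Finset.sum_filter, ← Finset.sum_filter, Finset.filter_filter]
  have h2 : K.edgeFinset.filter (fun e => e ⊆ t ∧ v ∈ e) =
      (Finset.powersetCard 2 t).filter (v ∈ ·) := by
    ext e
    simp only [Finset.mem_filter, mem_edgeFinset, edges, Set.mem_ofPred_eq,
      Finset.mem_powersetCard]
    exact ⟨fun h => ⟨⟨h.2.1, h.1.1⟩, h.2.2⟩, fun h => ⟨⟨h.1.2, t, ht, h.1.1⟩, h.1.1, h.2⟩⟩
  rw [h2]
  calc _ = ∑ e ∈ (Finset.powersetCard 2 t).filter (v ∈ ·), c t * 1 := by simp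
    _ = 0 := by rw [← Finset.mul_sum, h3, mul_zero]

end

end TriComplex

/-! ### Euler characteristic and first homology modulo 2 -/

namespace TriComplex

variable {V : Type} [DecidableEq V] (K : TriComplex V)

/-- The boundary matrix modulo `2` from edges to vertices. -/
def edgeMatrix : Matrix K.vertexFinset K.edgeFinset (ZMod 2) :=
  Matrix.of fun v e => if (v : V) ∈ (e : Finset V) then 1 else 0

/-- The boundary matrix modulo `2` from triangles to edges. -/
def triMatrix : Matrix K.edgeFinset K.triangles (ZMod 2) :=
  Matrix.of fun e t => if (e : Finset V) ⊆ (t : Finset V) then 1 else 0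

variable {K}

theorem edgeMatrix_mulVec (z : Finset V → ZMod 2) (v : K.vertexFinset) :
    (K.edgeMatrix.mulVec fun e => z e) v = K.vbd z v := by
  simp only [Matrix.mulVec, dotProduct, edgeMatrix, Matrix.of_apply, vbd, Finset.sum_filter]
  rw [← Finset.sum_coe_sort K.edgeFinset]
  exact Finset.sum_congr rfl fun e _ => by split_ifs <;> simp

theorem triMatrix_mulVec (c : Finset V → ZMod 2) (e : K.edgeFinset) :
    (K.triMatrix.mulVec fun t => c t) e = K.bd c e := by
  simp only [Matrix.mulVec, dotProduct, triMatrix, Matrix.of_apply, bd, triOn, Finset.sum_filter]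
  rw [← Finset.sum_coe_sort K.triangles]
  exact Finset.sum_congr rfl fun e _ => by split_ifs <;> simp

theorem exists_extension {s : Finset (Finset V)} (f : s → ZMod 2) :
    ∃ g : Finset V → ZMod 2, f = fun t : s => g t :=
  ⟨fun t => if h : t ∈ s then f ⟨t, h⟩ else 0, by ext t; simp⟩

theorem IsBorderedSurface.vertexFinset_nonempty (h : K.IsBorderedSurface) :
    K.vertexFinset.Nonempty := by
  obtain ⟨e, ⟨he, t, ht, -⟩, -⟩ := h.boundary_nonempty
  obtain ⟨x, hx⟩ := Finset.card_pos.1 (by rw [K.card_eq_three t ht]; norm_num : 0 < t.card)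
  exact ⟨x, mem_vertexFinset.2 ⟨t, ht, hx⟩⟩

/-- The kernel of the transpose consists of the vertex functions with equal values at the ends of
every edge. Connectedness leaves only the constants. -/
theorem IsBorderedSurface.rank_edgeMatrix (h : K.IsBorderedSurface) :
    K.edgeMatrix.rank + 1 = K.vertexFinset.card := by
  have hk : Module.finrank (ZMod 2) (LinearMap.ker K.edgeMatrix.transpose.mulVecLin) = 1 := by
    have hone : (fun _ => 1) ∈ LinearMap.ker K.edgeMatrix.transpose.mulVecLin := by
      rw [LinearMap.mem_ker]
      ext ⟨e, he⟩
      have he' := mem_edgeFinset.1 he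
      obtain ⟨x, y, hxy, rfl⟩ := Finset.card_eq_two.1 he'.1
      have hadj := pair_mem_edges.1 he'
      have hx := mem_vertexFinset.2 (mem_vertices_of_adj hadj)
      have hy := mem_vertexFinset.2 (mem_vertices_of_adj hadj.symm)
      simp only [Matrix.mulVecLin_apply, Matrix.mulVec, dotProduct, Matrix.transpose_apply,
        edgeMatrix, Matrix.of_apply, mul_one, Pi.zero_apply]
      rw [Finset.sum_coe_sort K.vertexFinset (fun v => if v ∈ ({x, y} : Finset V) then (1 : ZMod 2)
        else 0), ← Finset.sum_filter]
      have : K.vertexFinset.filter (· ∈ ({x, y} : Finset V)) = {x, y} := by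
        ext v
        simp only [Finset.mem_filter, Finset.mem_insert, Finset.mem_singleton]
        refine ⟨fun h => h.2, fun h => ⟨?_, h⟩⟩
        rcases h with rfl | rfl <;> assumption
      rw [this, Finset.sum_pair hxy]
      exact CharTwo.add_self_eq_zero 1
    obtain ⟨v₀, hv₀⟩ := h.vertexFinset_nonempty
    refine finrank_eq_one ⟨_, hone⟩ ?_ ?_
    · intro h0
      have := congrFun (congrArg Subtype.val h0) ⟨v₀, hv₀⟩
      simp at this
    · rintro ⟨f, hf⟩
      refine ⟨f ⟨v₀, hv₀⟩, ?_⟩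
      apply Subtype.ext
      ext ⟨w, hw⟩
      simp only [SetLike.val_smul, Pi.smul_apply, smul_eq_mul, mul_one]
      have key : ∀ hw : w ∈ K.vertexFinset, f ⟨v₀, hv₀⟩ = f ⟨w, hw⟩ := by
        refine (h.connected v₀ (mem_vertexFinset.1 hv₀) w (mem_vertexFinset.1 hw)).induct
          (P := fun w => ∀ hw : w ∈ K.vertexFinset, f ⟨v₀, hv₀⟩ = f ⟨w, hw⟩) ?_ (fun _ => rfl)
        intro x y hadj ih hy
        have hx := mem_vertexFinset.2 (mem_vertices_of_adj hadj)
        rw [ih hx]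
        have hxy : x ≠ y := hadj.1
        have he := mem_edgeFinset.2 (pair_mem_edges.2 hadj)
        have := congrFun (LinearMap.mem_ker.1 hf) ⟨_, he⟩
        simp only [Matrix.mulVecLin_apply, Matrix.mulVec, dotProduct, Matrix.transpose_apply,
          edgeMatrix, Matrix.of_apply, Pi.zero_apply, ite_mul, one_mul, zero_mul] at this
        rw [← Finset.sum_filter] at this
        have h2 : (Finset.univ : Finset K.vertexFinset).filter
            (fun v : K.vertexFinset => (v : V) ∈ ({x, y} : Finset V)) = {⟨x, hx⟩, ⟨y, hy⟩} := by
          ext ⟨v, hv⟩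
          simp
        rw [h2, Finset.sum_pair (by simpa using hxy)] at this
        exact CharTwo.add_eq_zero.1 this
      exact key hw
  have := K.edgeMatrix.transpose.mulVecLin.finrank_range_add_finrank_ker
  rw [hk, Module.finrank_pi, Fintype.card_coe] at this
  rw [← Matrix.rank_transpose, ← this, Matrix.rank]

/-- A bordered surface has Euler characteristic `1` if and only if every `1`-cycle modulo `2`
is a boundary. -/
theorem IsBorderedSurface.euler_char_iff (h : K.IsBorderedSurface) :
    (K.vertices.ncard : ℤ) - K.edges.ncard + K.triangles.card = 1 ↔
      ∀ z : Finset V → ZMod 2, (∀ v ∈ K.vertices, K.vbd z v = 0) →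
        ∃ c : Finset V → ZMod 2, ∀ e ∈ K.edges, K.bd c e = z e := by
  rw [ncard_edges, ncard_vertices]
  have h1 := h.rank_edgeMatrix
  have h2 := K.edgeMatrix.mulVecLin.finrank_range_add_finrank_ker
  rw [Module.finrank_pi, Fintype.card_coe] at h2
  change K.edgeMatrix.rank + _ = _ at h2
  have h3 : Module.finrank (ZMod 2) (LinearMap.range K.triMatrix.mulVecLin) =
      K.triangles.card := by
    rw [LinearMap.finrank_range_of_inj, Module.finrank_pi, Fintype.card_coe]
    rw [← LinearMap.ker_eq_bot, LinearMap.ker_eq_bot']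
    intro f hf
    obtain ⟨c, rfl⟩ := exists_extension f
    have hc : ∀ e ∈ K.edges, K.bd c e = 0 := by
      intro e he
      have := congrFun hf ⟨e, mem_edgeFinset.2 he⟩
      rwa [Matrix.mulVecLin_apply, triMatrix_mulVec] at this
    ext ⟨t, ht⟩
    exact h.eq_zero_of_bd_eq_zero hc t ht
  have h4 : LinearMap.range K.triMatrix.mulVecLin ≤ LinearMap.ker K.edgeMatrix.mulVecLin := by
    rintro _ ⟨f, rfl⟩
    obtain ⟨c, rfl⟩ := exists_extension f
    rw [LinearMap.mem_ker]
    have : K.triMatrix.mulVecLin (fun t => c t) = fun e : K.edgeFinset => K.bd c e := by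
      ext e
      rw [Matrix.mulVecLin_apply, triMatrix_mulVec]
    rw [this]
    ext v
    rw [Matrix.mulVecLin_apply, edgeMatrix_mulVec, vbd_bd, Pi.zero_apply]
  have h5 : (LinearMap.range K.triMatrix.mulVecLin = LinearMap.ker K.edgeMatrix.mulVecLin) ↔
      ∀ z : Finset V → ZMod 2, (∀ v ∈ K.vertices, K.vbd z v = 0) →
        ∃ c : Finset V → ZMod 2, ∀ e ∈ K.edges, K.bd c e = z e := by
    constructor
    · intro heq z hz
      have hm : (fun e : K.edgeFinset => z e) ∈ LinearMap.ker K.edgeMatrix.mulVecLin := by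
        rw [LinearMap.mem_ker]
        ext v
        rw [Matrix.mulVecLin_apply, edgeMatrix_mulVec, Pi.zero_apply]
        exact hz v (mem_vertexFinset.1 v.2)
      rw [← heq] at hm
      obtain ⟨f, hf⟩ := hm
      obtain ⟨c, rfl⟩ := exists_extension f
      refine ⟨c, fun e he => ?_⟩
      have := congrFun hf ⟨e, mem_edgeFinset.2 he⟩
      rwa [Matrix.mulVecLin_apply, triMatrix_mulVec] at this
    · intro hz
      refine le_antisymm h4 fun f hf => ?_
      obtain ⟨z, rfl⟩ := exists_extension f
      obtain ⟨c, hc⟩ := hz z fun v hv => by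
        have := congrFun (LinearMap.mem_ker.1 hf) ⟨v, mem_vertexFinset.2 hv⟩
        rwa [Matrix.mulVecLin_apply, edgeMatrix_mulVec] at this
      refine ⟨fun t => c t, ?_⟩
      ext e
      rw [Matrix.mulVecLin_apply, triMatrix_mulVec]
      exact hc e (mem_edgeFinset.1 e.2)
  rw [← h5]
  -- Boundaries lie inside cycles. Their dimensions are `F` and `E - (V - 1)`, with `V`, `E`, `F`
  -- the numbers of vertices, edges and triangles, so `V - E + F = 1` says exactly that the two
  -- spaces agree.
  constructor
  · intro he
    apply Submodule.eq_of_le_of_finrank_eq h4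
    omega
  · intro he
    rw [he] at h3
    omega

end TriComplex

/-! ### Collapsing a filled triangle -/

namespace TriComplex

section

variable {V : Type} [DecidableEq V]

theorem zmod_two_eq_one_of_ne_zero : ∀ {x : ZMod 2}, x ≠ 0 → x = 1 := by decide

/-- Remove the triangles in the support of the chain `c` and add the triangle `t₀`. -/
def collapse (K : TriComplex V) (c : Finset V → ZMod 2) (t₀ : Finset V) (h : t₀.card = 3) :
    TriComplex V where
  triangles := insert t₀ {t ∈ K.triangles | c t = 0}
  card_eq_three t ht := by
    rcases Finset.mem_insert.1 ht with rfl | ht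
    · exact h
    · exact K.card_eq_three t (Finset.mem_filter.1 ht).1

/-- The chain `c` fills the triangle `t₀`, all of whose edges belong to `K`. -/
structure Fills (K : TriComplex V) (c : Finset V → ZMod 2) (t₀ : Finset V) : Prop where
  card_eq_three : t₀.card = 3
  mem_edges : ∀ e ⊆ t₀, e.card = 2 → e ∈ K.edges
  bd_eq : ∀ e ∈ K.edges, K.bd c e = if e ⊆ t₀ then 1 else 0

variable {K : TriComplex V} {c : Finset V → ZMod 2} {t₀ : Finset V}

theorem mem_collapse {h : t₀.card = 3} {t : Finset V} :
    t ∈ (K.collapse c t₀ h).triangles ↔ t = t₀ ∨ (t ∈ K.triangles ∧ c t = 0) := by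
  simp [collapse]

theorem IsBorderedSurface.card_triOn_le (hK : K.IsBorderedSurface) {e : Finset V}
    (he : e ∈ K.edges) : (K.triOn e).card ≤ 2 := by
  rw [← ncard_trianglesOn]
  exact hK.edge_le_two e he

theorem bd_indicator (t e : Finset V) (ht : t ∈ K.triangles) :
    K.bd (fun s => if s = t then 1 else 0) e = if e ⊆ t then 1 else 0 := by
  rw [bd, Finset.sum_ite_eq']
  simp [mem_triOn, ht]

theorem bd_add (c c' : Finset V → ZMod 2) (e : Finset V) :
    K.bd (fun t => c t + c' t) e = K.bd c e + K.bd c' e :=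
  Finset.sum_add_distrib

theorem bd_mul_left (a : ZMod 2) (c : Finset V → ZMod 2) (e : Finset V) :
    K.bd (fun t => a * c t) e = a * K.bd c e :=
  (Finset.mul_sum _ _ _).symm

namespace Fills

/-- The indicator of `t₀` is also a filling, and fillings are unique because no nonzero 2-chain is
closed. Hence `t₀` is never among the triangles that are kept. -/
theorem eq_one_of_mem (hc : K.Fills c t₀) (hK : K.IsBorderedSurface) (ht : t₀ ∈ K.triangles) :
    c t₀ = 1 := by
  have := hK.eq_zero_of_bd_eq_zero (c := fun t => c t + if t = t₀ then 1 else 0)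
    (fun e he => by
      rw [bd_add, bd_indicator _ _ ht, hc.bd_eq e he]
      exact CharTwo.add_self_eq_zero _) t₀ ht
  rw [if_pos rfl] at this
  exact CharTwo.add_eq_zero.1 this

theorem eq_of_edge (hc : K.Fills c t₀) (hK : K.IsBorderedSurface) {e : Finset V}
    (he : e ∈ K.edges) (hne : ¬ e ⊆ t₀) {t₁ t₂ : Finset V} (h₁ : t₁ ∈ K.triangles)
    (h₂ : t₂ ∈ K.triangles) (he₁ : e ⊆ t₁) (he₂ : e ⊆ t₂) : c t₁ = c t₂ :=
  eq_of_bd_eq_zero (hK.card_triOn_le he) (by rw [hc.bd_eq e he, if_neg hne])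
    (mem_triOn.2 ⟨h₁, he₁⟩) (mem_triOn.2 ⟨h₂, he₂⟩)

/-- The boundary of `c` lives on the edges of `t₀`, so `c` cannot change around a vertex outside
`t₀`: the star of such a vertex is kept or removed as a whole. -/
theorem eq_of_vertex (hc : K.Fills c t₀) (hK : K.IsBorderedSurface) {v : V} (hv : v ∉ t₀)
    {t₁ t₂ : Finset V} (h₁ : t₁ ∈ K.triangles) (h₂ : t₂ ∈ K.triangles) (hv₁ : v ∈ t₁)
    (hv₂ : v ∈ t₂) : c t₁ = c t₂ :=
  eq_of_bd_eq_zero_at hK.edge_le_two (hK.link_connected v ⟨t₁, h₁, hv₁⟩)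
    (fun e he hve => by rw [hc.bd_eq e he, if_neg fun h => hv (h hve)]) h₁ h₂ hv₁ hv₂

theorem collapse_edges_subset (hc : K.Fills c t₀) {e : Finset V}
    (he : e ∈ (K.collapse c t₀ hc.card_eq_three).edges) : e ∈ K.edges := by
  obtain ⟨h2, t, ht, het⟩ := he
  rcases mem_collapse.1 ht with rfl | ⟨ht, -⟩
  · exact hc.mem_edges e het h2
  · exact ⟨h2, t, ht, het⟩

theorem adj_of_collapse_adj (hc : K.Fills c t₀) {v w : V}
    (h : (K.collapse c t₀ hc.card_eq_three).graph.Adj v w) : K.graph.Adj v w :=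
  pair_mem_edges.1 (hc.collapse_edges_subset (pair_mem_edges.2 h))

theorem collapse_vertices_subset (hc : K.Fills c t₀) {v : V}
    (hv : v ∈ (K.collapse c t₀ hc.card_eq_three).vertices) : v ∈ K.vertices := by
  obtain ⟨t, ht, hvt⟩ := hv
  obtain ⟨w, -, hw⟩ := exists_adj_of_mem ht hvt
  exact mem_vertices_of_adj (hc.adj_of_collapse_adj hw)

theorem not_mem_filter (hc : K.Fills c t₀) (hK : K.IsBorderedSurface) :
    t₀ ∉ K.triangles.filter (c · = 0) := by
  intro h
  rw [Finset.mem_filter] at h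
  rw [hc.eq_one_of_mem hK h.1] at h
  exact one_ne_zero h.2

theorem bd_collapse (hc : K.Fills c t₀) (hK : K.IsBorderedSurface) (c' : Finset V → ZMod 2)
    (e : Finset V) : (K.collapse c t₀ hc.card_eq_three).bd c' e =
      (if e ⊆ t₀ then c' t₀ else 0) + K.bd (fun t => if c t = 0 then c' t else 0) e := by
  simp only [bd, triOn, collapse, Finset.sum_filter]
  rw [Finset.sum_insert (hc.not_mem_filter hK), Finset.sum_filter]
  congr 1
  exact Finset.sum_congr rfl fun t _ => by split_ifs <;> rfl

/-- On an edge of `t₀` the chain `c` has odd sum, so at least one triangle there disappears and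
makes room for `t₀`. -/
theorem card_triOn_collapse_le (hc : K.Fills c t₀) (hK : K.IsBorderedSurface) {e : Finset V}
    (he : e ∈ K.edges) : ((K.collapse c t₀ hc.card_eq_three).triOn e).card ≤ 2 := by
  have h2 := hK.card_triOn_le he
  by_cases hs : e ⊆ t₀
  · have hb := hc.bd_eq e he
    rw [if_pos hs] at hb
    obtain ⟨t₁, ht₁, hne⟩ := Finset.exists_ne_zero_of_sum_ne_zero
      (s := K.triOn e) (f := c) (by rw [← bd, hb]; exact one_ne_zero)
    have hsub : (K.collapse c t₀ hc.card_eq_three).triOn e ⊆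
        insert t₀ ((K.triOn e).erase t₁) := by
      intro t ht
      rw [mem_triOn, mem_collapse] at ht
      rw [Finset.mem_insert, Finset.mem_erase, mem_triOn]
      rcases ht with ⟨rfl | ht, het⟩
      · exact .inl rfl
      · refine .inr ⟨?_, ht.1, het⟩
        rintro rfl
        exact hne ht.2
    have h3 := (Finset.card_le_card hsub).trans (Finset.card_insert_le _ _)
    rw [Finset.card_erase_of_mem ht₁] at h3
    omega
  · refine (Finset.card_le_card fun t ht => ?_).trans h2
    rw [mem_triOn, mem_collapse] at ht
    rw [mem_triOn]
    rcases ht with ⟨rfl | ht, het⟩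
    · exact absurd het hs
    · exact ⟨ht.1, het⟩

end Fills

/-- With at most two triangles on an edge, parity detects the boundary. Exchanging a chain for
another with the same boundary modulo 2 therefore keeps the boundary edges. -/
theorem mem_boundaryEdges_iff {e : Finset V} (h2 : e ∈ K.edges → (K.triOn e).card ≤ 2) :
    e ∈ K.boundaryEdges ↔ e.card = 2 ∧ K.bd (fun _ => 1) e = 1 := by
  have hb : K.bd (fun _ => 1) e = ((K.triOn e).card : ZMod 2) := by simp [bd]
  rw [hb]
  simp only [boundaryEdges, Set.mem_ofPred_eq, ncard_trianglesOn]
  constructor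
  · rintro ⟨he, h1⟩
    exact ⟨he.1, by rw [h1]; rfl⟩
  · rintro ⟨hc, h1⟩
    have hne : (K.triOn e).card ≠ 0 := by
      intro h0
      rw [h0] at h1
      exact absurd h1 (by decide)
    obtain ⟨t, ht⟩ := Finset.card_ne_zero.1 hne
    rw [mem_triOn] at ht
    have he : e ∈ K.edges := ⟨hc, t, ht⟩
    refine ⟨he, ?_⟩
    have h2 := h2 he
    generalize (K.triOn e).card = m at *
    interval_cases m
    · exact absurd rfl hne
    · rfl
    · exact absurd h1 (by decide)

theorem boundaryEdges_eq_of_bd_eq {K' : TriComplex V}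
    (h2 : ∀ e ∈ K.edges, (K.triOn e).card ≤ 2) (h2' : ∀ e ∈ K'.edges, (K'.triOn e).card ≤ 2)
    (h : ∀ e : Finset V, e.card = 2 → K'.bd (fun _ => 1) e = K.bd (fun _ => 1) e) :
    K'.boundaryEdges = K.boundaryEdges := by
  ext e
  rw [mem_boundaryEdges_iff (h2 e), mem_boundaryEdges_iff (h2' e)]
  exact and_congr_right fun hc => by rw [h e hc]

theorem bd_eq_zero_of_not_mem_edges {e : Finset V} (h2 : e.card = 2) (he : e ∉ K.edges)
    (c : Finset V → ZMod 2) : K.bd c e = 0 :=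
  Finset.sum_eq_zero fun t ht => absurd ⟨h2, t, mem_triOn.1 ht⟩ he

namespace Fills

theorem boundaryEdges_collapse (hc : K.Fills c t₀) (hK : K.IsBorderedSurface) :
    (K.collapse c t₀ hc.card_eq_three).boundaryEdges = K.boundaryEdges := by
  refine boundaryEdges_eq_of_bd_eq (fun e => hK.card_triOn_le)
    (fun e he => hc.card_triOn_collapse_le hK (hc.collapse_edges_subset he)) fun e h2 => ?_
  rw [hc.bd_collapse hK]
  have h1 : K.bd (fun _ => 1) e = K.bd c e + K.bd (fun t => if c t = 0 then 1 else 0) e := by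
    rw [← bd_add]
    refine Finset.sum_congr rfl fun t _ => ?_
    beta_reduce
    split_ifs with h
    · rw [h, zero_add]
    · rw [zmod_two_eq_one_of_ne_zero h, add_zero]
  rw [h1]
  congr 1
  by_cases he : e ∈ K.edges
  · exact (hc.bd_eq e he).symm
  · rw [if_neg fun h => he (hc.mem_edges e h h2), bd_eq_zero_of_not_mem_edges h2 he]

theorem collapse_graph_adj (hc : K.Fills c t₀) {v w : V} (hvw : v ≠ w) (hv : v ∈ t₀)
    (hw : w ∈ t₀) : (K.collapse c t₀ hc.card_eq_three).graph.Adj v w :=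
  ⟨hvw, t₀, mem_collapse.2 (.inl rfl), hv, hw⟩

theorem link_collapse_of_mem (hc : K.Fills c t₀) (hK : K.IsBorderedSurface) {p : V}
    (hp : p ∈ t₀) {x y : V} (hx : (K.collapse c t₀ hc.card_eq_three).graph.Adj p x)
    (hy : (K.collapse c t₀ hc.card_eq_three).graph.Adj p y) :
    ((K.collapse c t₀ hc.card_eq_three).link p).Reachable x y := by
  classical
  obtain ⟨q, hq, hqp⟩ := Finset.exists_mem_ne (s := t₀) (by rw [hc.card_eq_three]; norm_num) p
  set K' := K.collapse c t₀ hc.card_eq_three with hK'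
  -- A retraction of the old link onto the new one: what is swallowed by the chain, together with
  -- the vertices of `t₀`, goes to the vertex `q` of `t₀`.
  set f : V → V := fun w => if w ∈ t₀ ∨ ∀ t ∈ K.triOn {p, w}, c t ≠ 0 then q else w with hf
  have ht₀ : t₀ ∈ K'.triangles := mem_collapse.2 (.inl rfl)
  have near : ∀ w, K'.graph.Adj p w → (K'.link p).Reachable w (f w) := by
    intro w hw
    by_cases hwt : w ∈ t₀
    · have : f w = q := if_pos (.inl hwt)
      rw [this]
      by_cases hwq : w = q
      · rw [hwq]
      · exact SimpleGraph.Adj.reachable ⟨hwq, hw.1.symm, hqp, t₀, ht₀, hp, hwt, hq⟩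
    · have : f w = w := by
        refine if_neg ?_
        rintro (h | h)
        · exact hwt h
        · obtain ⟨-, t, ht, hpt, hwt'⟩ := hw
          rcases mem_collapse.1 ht with rfl | ht
          · exact hwt hwt'
          · exact h t (by simp [mem_triOn, Finset.insert_subset_iff, *]) ht.2
      rw [this]
  have step : ∀ w w', (K.link p).Adj w w' → (K'.link p).Reachable (f w) (f w') := by
    rintro w w' ⟨hww, hwp, hwp', t, ht, hpt, hwt, hwt'⟩
    by_cases h0 : c t = 0
    · have htK : t ∈ K'.triangles := mem_collapse.2 (.inr ⟨ht, h0⟩)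
      have hadj : (K'.link p).Adj w w' := ⟨hww, hwp, hwp', t, htK, hpt, hwt, hwt'⟩
      exact ((near w ⟨hwp.symm, t, htK, hpt, hwt⟩).symm.trans hadj.reachable).trans
        (near w' ⟨hwp'.symm, t, htK, hpt, hwt'⟩)
    · have : ∀ u ∈ t, u ≠ p → f u = q := by
        intro u hu hup
        refine if_pos ?_
        by_cases hut : u ∈ t₀
        · exact .inl hut
        · refine .inr fun s hs => ?_
          rw [mem_triOn, Finset.insert_subset_iff, Finset.singleton_subset_iff] at hs
          rwa [hc.eq_of_vertex hK hut hs.1 ht hs.2.2 hu]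
      rw [this w hwt hwp, this w' hwt' hwp']
  exact ((near x hx).trans ((hK.link_connected p
    (mem_vertices_of_adj (hc.adj_of_collapse_adj hx)) x y (hc.adj_of_collapse_adj hx)
    (hc.adj_of_collapse_adj hy)).map_of_adj f step)).trans (near y hy).symm

theorem isBorderedSurface_collapse (hc : K.Fills c t₀) (hK : K.IsBorderedSurface) :
    (K.collapse c t₀ hc.card_eq_three).IsBorderedSurface where
  edge_le_two e he := by
    rw [ncard_trianglesOn]
    exact hc.card_triOn_collapse_le hK (hc.collapse_edges_subset he)
  link_connected v hv x y hx hy := by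
    by_cases hvt : v ∈ t₀
    · exact hc.link_collapse_of_mem hK hvt hx hy
    · have h0 : ∀ t ∈ K.triangles, v ∈ t → c t = 0 := by
        intro t ht hvt'
        obtain ⟨-, s, hs, hvs, -⟩ := hx
        rcases mem_collapse.1 hs with rfl | hs
        · exact absurd hvs hvt
        · rw [hc.eq_of_vertex hK hvt ht hs.1 hvt' hvs, hs.2]
      refine (hK.link_connected v (hc.collapse_vertices_subset hv) x y
        (hc.adj_of_collapse_adj hx) (hc.adj_of_collapse_adj hy)).mono ?_
      rintro w w' ⟨h1, h2, h3, t, ht, hv', hw⟩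
      exact ⟨h1, h2, h3, t, mem_collapse.2 (.inr ⟨ht, h0 t ht hv'⟩), hv', hw⟩
  connected x hx y hy := by
    classical
    obtain ⟨p, hp⟩ := Finset.card_pos.1 (by rw [hc.card_eq_three]; norm_num : 0 < t₀.card)
    set K' := K.collapse c t₀ hc.card_eq_three with hK'
    set f : V → V := fun w => if w ∈ t₀ ∨ ∀ t ∈ K.triOn {w}, c t ≠ 0 then p else w with hf
    have near : ∀ w ∈ K'.vertices, K'.graph.Reachable w (f w) := by
      rintro w ⟨t, ht, hwt'⟩
      by_cases hwt : w ∈ t₀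
      · have : f w = p := if_pos (.inl hwt)
        rw [this]
        by_cases hwp : w = p
        · rw [hwp]
        · exact (hc.collapse_graph_adj hwp hwt hp).reachable
      · have : f w = w := by
          refine if_neg ?_
          rintro (h | h)
          · exact hwt h
          · rcases mem_collapse.1 ht with rfl | ht
            · exact hwt hwt'
            · exact h t (by simp [mem_triOn, *]) ht.2
        rw [this]
    have step : ∀ w w', K.graph.Adj w w' → K'.graph.Reachable (f w) (f w') := by
      rintro w w' ⟨hww, t, ht, hwt, hwt'⟩
      by_cases h0 : c t = 0
      · have htK : t ∈ K'.triangles := mem_collapse.2 (.inr ⟨ht, h0⟩)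
        have hadj : K'.graph.Adj w w' := ⟨hww, t, htK, hwt, hwt'⟩
        exact ((near w ⟨t, htK, hwt⟩).symm.trans hadj.reachable).trans (near w' ⟨t, htK, hwt'⟩)
      · have : ∀ u ∈ t, f u = p := by
          intro u hu
          refine if_pos ?_
          by_cases hut : u ∈ t₀
          · exact .inl hut
          · refine .inr fun s hs => ?_
            rw [mem_triOn, Finset.singleton_subset_iff] at hs
            rwa [hc.eq_of_vertex hK hut hs.1 ht hs.2 hu]
        rw [this w hwt, this w' hwt']
    exact ((near x hx).trans ((hK.connected x (hc.collapse_vertices_subset hx) y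
      (hc.collapse_vertices_subset hy)).map_of_adj f step)).trans (near y hy).symm
  boundary_nonempty := by
    rw [hc.boundaryEdges_collapse hK]
    exact hK.boundary_nonempty

/-- A cycle supported on the edges of a triangle is a multiple of the boundary of the triangle. -/
theorem exists_eq_mul (hc : K.Fills c t₀) {z : Finset V → ZMod 2}
    (hz : ∀ e ∈ K.edges, ¬ e ⊆ t₀ → z e = 0) (hv : ∀ v, K.vbd z v = 0) :
    ∃ a : ZMod 2, ∀ e ∈ K.edges, z e = a * if e ⊆ t₀ then 1 else 0 := by
  obtain ⟨p, q, r, hpq, hpr, hqr, rfl⟩ := Finset.card_eq_three.1 hc.card_eq_three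
  -- At a corner of `t₀` only the two sides of `t₀` can carry `z`, so the cycle condition equates
  -- their coefficients.
  have key : ∀ x y w : V, x ≠ y → x ≠ w → y ≠ w → ({p, q, r} : Finset V) = {x, y, w} →
      z {x, y} = z {x, w} := by
    intro x y w hxy hxw hyw h
    have h1 := hv x
    have hs : ∑ e ∈ K.edgeFinset with x ∈ e, z e = ∑ e ∈ ({{x, y}, {x, w}} : Finset _), z e := by
      symm
      apply Finset.sum_subset
      · intro e he
        rw [Finset.mem_insert, Finset.mem_singleton] at he
        rw [Finset.mem_filter, mem_edgeFinset]
        rcases he with rfl | rfl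
        · exact ⟨hc.mem_edges _ (by rw [h]; grind) (Finset.card_pair hxy), by simp⟩
        · exact ⟨hc.mem_edges _ (by rw [h]; grind) (Finset.card_pair hxw), by simp⟩
      · intro e he hne
        rw [Finset.mem_filter, mem_edgeFinset] at he
        refine hz e he.1 fun hs => hne ?_
        obtain ⟨u, hu, rfl⟩ := Finset.exists_eq_of_card_eq_two he.1.1 he.2
        rw [h] at hs
        have : u ∈ ({x, y, w} : Finset V) := hs (by simp)
        grind
    have hne : ({x, y} : Finset V) ≠ {x, w} := by
      intro h
      have : y ∈ ({x, w} : Finset V) := by rw [← h]; simp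
      grind
    rw [vbd, hs, Finset.sum_pair hne] at h1
    exact CharTwo.add_eq_zero.1 h1
  have h1 := key p q r hpq hpr hqr rfl
  have h2 := key q p r hpq.symm hqr hpr (by grind)
  refine ⟨z {p, q}, fun e he => ?_⟩
  split_ifs with hs
  · rw [mul_one]
    obtain ⟨u, v, huv, rfl⟩ := Finset.card_eq_two.1 he.1
    have hu : u ∈ ({p, q, r} : Finset V) := hs (by simp)
    have hv : v ∈ ({p, q, r} : Finset V) := hs (by simp)
    rw [Finset.pair_comm q p] at h2
    simp only [Finset.mem_insert, Finset.mem_singleton] at hu hv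
    rcases hu with rfl | rfl | rfl <;> rcases hv with rfl | rfl | rfl
    · exact absurd rfl huv
    · rfl
    · exact h1.symm
    · rw [Finset.pair_comm]
    · exact absurd rfl huv
    · exact h2.symm
    · rw [Finset.pair_comm, h1]
    · rw [Finset.pair_comm, h2]
    · exact absurd rfl huv
  · rw [mul_zero]
    exact hz e he hs

/-- Replacing a filling of a triangle by the triangle turns a disc into a disc. -/
theorem isDisc_collapse (hc : K.Fills c t₀) (hD : K.IsDisc) :
    (K.collapse c t₀ hc.card_eq_three).IsDisc := by
  classical
  have hK := hD.isBorderedSurface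
  have hK' := hc.isBorderedSurface_collapse hK
  refine ⟨hK'.edge_le_two, hK'.link_connected, hK'.connected, hK'.boundary_nonempty, ?_⟩
  rw [hK'.euler_char_iff]
  intro z hz
  obtain ⟨c₁, hc₁⟩ := hK.euler_char_iff.1 hD.euler_char
    (fun e => if e ∈ (K.collapse c t₀ hc.card_eq_three).edges then z e else 0) (by
      intro v _
      have h1 : K.vbd (fun e => if e ∈ (K.collapse c t₀ hc.card_eq_three).edges then z e else 0) v
          = (K.collapse c t₀ hc.card_eq_three).vbd z v := by
        simp only [vbd, ← Finset.sum_filter, Finset.filter_filter]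
        congr 1
        ext e
        simp only [Finset.mem_filter, mem_edgeFinset]
        exact ⟨fun h => ⟨h.2.2, h.2.1⟩, fun h => ⟨hc.collapse_edges_subset h.1, h.2, h.1⟩⟩
      rw [h1]
      by_cases hv : v ∈ (K.collapse c t₀ hc.card_eq_three).vertices
      · exact hz v hv
      · refine Finset.sum_eq_zero fun e he => ?_
        rw [Finset.mem_filter, mem_edgeFinset] at he
        obtain ⟨⟨-, t, ht, het⟩, hve⟩ := he
        exact absurd ⟨t, ht, het hve⟩ hv)
  -- The part of `c₁` inside the filling has boundary only on `t₀`: off `t₀`, `c` is constant on the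
  -- triangles at `e`, and an edge interior to the filling is absent from the new complex, where the
  -- extended cycle vanishes.
  have hz₂ : ∀ e ∈ K.edges, ¬ e ⊆ t₀ → K.bd (fun t => c t * c₁ t) e = 0 := by
    intro e he hs
    obtain ⟨h2, t, ht, het⟩ := id he
    have hconst : K.bd (fun t => c t * c₁ t) e = c t * K.bd c₁ e := by
      rw [← bd_mul_left]
      refine Finset.sum_congr rfl fun s hs' => ?_
      rw [mem_triOn] at hs'
      beta_reduce
      rw [hc.eq_of_edge hK he hs hs'.1 ht hs'.2 het]
    rw [hconst]
    by_cases h0 : c t = 0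
    · rw [h0, zero_mul]
    · rw [hc₁ e he, if_neg, mul_zero]
      rintro ⟨-, s, hs', hes⟩
      rcases mem_collapse.1 hs' with rfl | hs'
      · exact hs hes
      · exact h0 (by rw [hc.eq_of_edge hK he hs ht hs'.1 het hes, hs'.2])
  obtain ⟨a, ha⟩ := hc.exists_eq_mul hz₂ (vbd_bd _)
  -- The removed part of `c₁` has boundary `a • ∂t₀`, so the coefficient `a` on `t₀` replaces it.
  refine ⟨fun t => if t = t₀ then a else c₁ t, fun e he => ?_⟩
  have heK := hc.collapse_edges_subset he
  rw [hc.bd_collapse hK, if_pos rfl]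
  have h1 := hc₁ e heK
  rw [if_pos he] at h1
  rw [← h1]
  have h2 : K.bd c₁ e = K.bd (fun t => c t * c₁ t) e +
      K.bd (fun t => if c t = 0 then if t = t₀ then a else c₁ t else 0) e := by
    rw [← bd_add]
    refine Finset.sum_congr rfl fun t ht => ?_
    rw [mem_triOn] at ht
    beta_reduce
    by_cases h0 : c t = 0
    · have hne : t ≠ t₀ := by
        rintro rfl
        rw [hc.eq_one_of_mem hK ht.1] at h0
        exact one_ne_zero h0
      rw [if_pos h0, if_neg hne, h0, zero_mul, zero_add]
    · rw [if_neg h0, zmod_two_eq_one_of_ne_zero h0, one_mul, add_zero]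
  rw [h2, ha e heK]
  congr 1
  split_ifs <;> simp

end Fills

end

end TriComplex

/-! ### Edge flips -/

namespace TriComplex

section

variable {V : Type} [DecidableEq V]

/-- The four faces of a tetrahedron contain every edge an even number of times. -/
theorem tetrahedron_boundary {a x y z : V} (hax : a ≠ x) (hay : a ≠ y) (haz : a ≠ z)
    (hxy : x ≠ y) (hxz : x ≠ z) (hyz : y ≠ z) {e : Finset V} (he : e.card = 2) :
    (if e ⊆ {a, x, z} then (1 : ZMod 2) else 0) + (if e ⊆ {x, y, z} then 1 else 0) =
      (if e ⊆ {a, x, y} then 1 else 0) + if e ⊆ {a, y, z} then 1 else 0 := by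
  have h2 : (1 : ZMod 2) + 1 = 0 := rfl
  obtain ⟨u, v, huv, rfl⟩ := Finset.card_eq_two.1 he
  simp only [Finset.insert_subset_iff, Finset.singleton_subset_iff, Finset.mem_insert,
    Finset.mem_singleton]
  grind

/-- `K'` is obtained from `K` by replacing the triangles `a x y` and `a y z` on the edge `a y` by
the triangles `a x z` and `x y z` on the new edge `x z`. -/
structure IsFlip (K K' : TriComplex V) (a x y z : V) : Prop where
  hax : a ≠ x
  hay : a ≠ y
  haz : a ≠ z
  hxy : x ≠ y
  hxz : x ≠ z
  hyz : y ≠ z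
  mem_axy : {a, x, y} ∈ K.triangles
  mem_ayz : {a, y, z} ∈ K.triangles
  not_adj : ∀ t ∈ K.triangles, x ∈ t → z ∉ t
  eq_or_eq : ∀ t ∈ K.triangles, a ∈ t → y ∈ t → t = {a, x, y} ∨ t = {a, y, z}
  mem_iff : ∀ t, t ∈ K'.triangles ↔
    t = {a, x, z} ∨ t = {x, y, z} ∨ (t ∈ K.triangles ∧ ¬ (a ∈ t ∧ y ∈ t))

/-- The complex with the triangles `a x y` and `a y z` replaced by `a x z` and `x y z`. -/
def flip (K : TriComplex V) (a x y z : V) (h₁ : ({a, x, z} : Finset V).card = 3)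
    (h₂ : ({x, y, z} : Finset V).card = 3) : TriComplex V where
  triangles := insert {a, x, z} (insert {x, y, z} {t ∈ K.triangles | ¬ (a ∈ t ∧ y ∈ t)})
  card_eq_three t ht := by
    simp only [Finset.mem_insert, Finset.mem_filter] at ht
    rcases ht with rfl | rfl | ht
    exacts [h₁, h₂, K.card_eq_three t ht.1]

namespace IsFlip

variable {K K' : TriComplex V} {a x y z : V}

/-- With `swap_sides` this generates the symmetries of the quadrilateral, so one side, one end `a`
and one vertex `x` suffice below. -/
theorem swap_ends (h : IsFlip K K' a x y z) : IsFlip K K' y x a z where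
  hax := h.hxy.symm
  hay := h.hay.symm
  haz := h.hyz
  hxy := h.hax.symm
  hxz := h.hxz
  hyz := h.haz
  mem_axy := by
    rw [show ({y, x, a} : Finset V) = {a, x, y} by grind]
    exact h.mem_axy
  mem_ayz := by
    rw [Finset.insert_comm]
    exact h.mem_ayz
  not_adj := h.not_adj
  eq_or_eq t ht h1 h2 := by
    rw [show ({y, x, a} : Finset V) = {a, x, y} by grind, Finset.insert_comm y a]
    exact h.eq_or_eq t ht h2 h1
  mem_iff t := by
    rw [h.mem_iff, Finset.insert_comm y x, Finset.insert_comm x a, and_comm (a := y ∈ t)]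
    tauto

theorem swap_sides (h : IsFlip K K' a x y z) : IsFlip K K' a z y x where
  hax := h.haz
  hay := h.hay
  haz := h.hax
  hxy := h.hyz.symm
  hxz := h.hxz.symm
  hyz := h.hxy.symm
  mem_axy := by
    rw [Finset.pair_comm]
    exact h.mem_ayz
  mem_ayz := by
    rw [Finset.pair_comm]
    exact h.mem_axy
  not_adj t ht h1 h2 := h.not_adj t ht h2 h1
  eq_or_eq t ht h1 h2 := by
    rw [Finset.pair_comm z y, Finset.pair_comm y x]
    exact (h.eq_or_eq t ht h1 h2).symm
  mem_iff t := by
    rw [h.mem_iff, Finset.pair_comm z x, show ({z, y, x} : Finset V) = {x, y, z} by grind]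

theorem axz_mem (h : IsFlip K K' a x y z) : {a, x, z} ∈ K'.triangles :=
  (h.mem_iff _).2 (.inl rfl)

theorem xyz_mem (h : IsFlip K K' a x y z) : {x, y, z} ∈ K'.triangles :=
  (h.mem_iff _).2 (.inr (.inl rfl))

theorem mem_of_mem (h : IsFlip K K' a x y z) {t : Finset V} (ht : t ∈ K.triangles)
    (hn : ¬ (a ∈ t ∧ y ∈ t)) : t ∈ K'.triangles :=
  (h.mem_iff _).2 (.inr (.inr ⟨ht, hn⟩))

theorem adj_or (h : IsFlip K K' a x y z) {v w : V} (hvw : K'.graph.Adj v w) :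
    K.graph.Adj v w ∨ (v = x ∧ w = z) ∨ (v = z ∧ w = x) := by
  obtain ⟨hne, t, ht, hv, hw⟩ := hvw
  have hxz := h.hxz
  have h1 := h.mem_axy
  have h2 := h.mem_ayz
  rcases (h.mem_iff t).1 ht with rfl | rfl | ht
  · simp only [Finset.mem_insert, Finset.mem_singleton] at hv hw
    by_cases hn : v ≠ z ∧ w ≠ z
    · exact .inl ⟨hne, _, h1, by grind, by grind⟩
    · by_cases hn : v ≠ x ∧ w ≠ x
      · exact .inl ⟨hne, _, h2, by grind, by grind⟩
      · grind
  · simp only [Finset.mem_insert, Finset.mem_singleton] at hv hw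
    by_cases hn : v ≠ z ∧ w ≠ z
    · exact .inl ⟨hne, _, h1, by grind, by grind⟩
    · by_cases hn : v ≠ x ∧ w ≠ x
      · exact .inl ⟨hne, _, h2, by grind, by grind⟩
      · grind
  · exact .inl ⟨hne, t, ht.1, hv, hw⟩

theorem not_adj_ends (h : IsFlip K K' a x y z) : ¬ K'.graph.Adj a y := by
  rintro ⟨-, t, ht, ha, hy⟩
  have := h.hax; have := h.hay; have := h.haz; have := h.hxy; have := h.hyz
  rcases (h.mem_iff t).1 ht with rfl | rfl | ht
  · simp only [Finset.mem_insert, Finset.mem_singleton] at hy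
    grind
  · simp only [Finset.mem_insert, Finset.mem_singleton] at ha
    grind
  · exact ht.2 ⟨ha, hy⟩

theorem adj_of_adj (h : IsFlip K K' a x y z) {v w : V} (hvw : K.graph.Adj v w)
    (h1 : ¬ (v = a ∧ w = y)) (h2 : ¬ (v = y ∧ w = a)) : K'.graph.Adj v w := by
  obtain ⟨hne, t, ht, hv, hw⟩ := hvw
  by_cases hn : a ∈ t ∧ y ∈ t
  · rcases h.eq_or_eq t ht hn.1 hn.2 with rfl | rfl
    · simp only [Finset.mem_insert, Finset.mem_singleton] at hv hw
      by_cases hy : v ≠ y ∧ w ≠ y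
      · exact ⟨hne, _, h.axz_mem, by grind, by grind⟩
      · exact ⟨hne, _, h.xyz_mem, by grind, by grind⟩
    · simp only [Finset.mem_insert, Finset.mem_singleton] at hv hw
      by_cases hy : v ≠ y ∧ w ≠ y
      · exact ⟨hne, _, h.axz_mem, by grind, by grind⟩
      · exact ⟨hne, _, h.xyz_mem, by grind, by grind⟩
  · exact ⟨hne, t, h.mem_of_mem ht hn, hv, hw⟩

theorem edges_eq (h : IsFlip K K' a x y z) :
    K'.edges = insert {x, z} (K.edges \ {{a, y}}) := by
  have := h.hay
  have hxz : K'.graph.Adj x z := ⟨h.hxz, _, h.axz_mem, by simp, by simp⟩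
  ext e
  constructor
  · intro he
    obtain ⟨u, v, huv, rfl⟩ := Finset.card_eq_two.1 he.1
    rw [pair_mem_edges] at he
    rcases h.adj_or he with hK | ⟨rfl, rfl⟩ | ⟨rfl, rfl⟩
    · refine .inr ⟨pair_mem_edges.2 hK, fun heq => ?_⟩
      rw [Set.mem_singleton_iff] at heq
      rw [← pair_mem_edges, heq, pair_mem_edges] at he
      exact h.not_adj_ends he
    · exact .inl rfl
    · exact .inl (Finset.pair_comm _ _)
  · rintro (rfl | ⟨he, hne⟩)
    · exact pair_mem_edges.2 hxz
    · obtain ⟨u, v, huv, rfl⟩ := Finset.card_eq_two.1 he.1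
      rw [pair_mem_edges] at he ⊢
      refine h.adj_of_adj he ?_ ?_
      · rintro ⟨rfl, rfl⟩
        exact hne rfl
      · rintro ⟨rfl, rfl⟩
        exact hne (Finset.pair_comm _ _)

theorem vertices_eq (h : IsFlip K K' a x y z) : K'.vertices = K.vertices := by
  ext v
  constructor
  · rintro ⟨t, ht, hv⟩
    rcases (h.mem_iff t).1 ht with rfl | rfl | ht
    · by_cases hz : v = z
      · exact ⟨_, h.mem_ayz, by simp [hz]⟩
      · exact ⟨_, h.mem_axy, by grind⟩
    · by_cases hz : v = z
      · exact ⟨_, h.mem_ayz, by simp [hz]⟩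
      · exact ⟨_, h.mem_axy, by grind⟩
    · exact ⟨t, ht.1, hv⟩
  · rintro ⟨t, ht, hv⟩
    by_cases hn : a ∈ t ∧ y ∈ t
    · by_cases hy : v = y
      · exact ⟨_, h.xyz_mem, by simp [hy]⟩
      · refine ⟨_, h.axz_mem, ?_⟩
        rcases h.eq_or_eq t ht hn.1 hn.2 with rfl | rfl <;> grind
    · exact ⟨t, h.mem_of_mem ht hn, hv⟩

theorem axy_ne_ayz (h : IsFlip K K' a x y z) : ({a, x, y} : Finset V) ≠ {a, y, z} := by
  intro heq
  have : x ∈ ({a, y, z} : Finset V) := heq ▸ (by simp)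
  simp [h.hax.symm, h.hxy, h.hxz] at this

theorem axz_ne_xyz (h : IsFlip K K' a x y z) : ({a, x, z} : Finset V) ≠ {x, y, z} := by
  intro heq
  have : a ∈ ({x, y, z} : Finset V) := heq ▸ (by simp)
  simp [h.hax, h.hay, h.haz] at this

theorem filter_eq (h : IsFlip K K' a x y z) :
    K.triangles.filter (fun t => a ∈ t ∧ y ∈ t) = {{a, x, y}, {a, y, z}} := by
  ext t
  simp only [Finset.mem_filter, Finset.mem_insert, Finset.mem_singleton]
  constructor
  · rintro ⟨ht, ha, hy⟩
    exact h.eq_or_eq t ht ha hy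
  · rintro (rfl | rfl)
    · exact ⟨h.mem_axy, by simp⟩
    · exact ⟨h.mem_ayz, by simp⟩

theorem sum_eq (h : IsFlip K K' a x y z) {M : Type} [AddCommMonoid M] (f : Finset V → M) :
    ∑ t ∈ K.triangles, f t = (f {a, x, y} + f {a, y, z}) +
      ∑ t ∈ K.triangles with ¬ (a ∈ t ∧ y ∈ t), f t := by
  rw [← Finset.sum_filter_add_sum_filter_not K.triangles (fun t => a ∈ t ∧ y ∈ t), h.filter_eq,
    Finset.sum_pair h.axy_ne_ayz]

theorem sum_eq' (h : IsFlip K K' a x y z) {M : Type} [AddCommMonoid M] (f : Finset V → M) :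
    ∑ t ∈ K'.triangles, f t = (f {a, x, z} + f {x, y, z}) +
      ∑ t ∈ K.triangles with ¬ (a ∈ t ∧ y ∈ t), f t := by
  have h1 : K'.triangles =
      insert {a, x, z} (insert {x, y, z} (K.triangles.filter fun t => ¬ (a ∈ t ∧ y ∈ t))) := by
    ext t
    rw [h.mem_iff]
    simp
  rw [h1, Finset.sum_insert, Finset.sum_insert, add_assoc]
  · intro hm
    exact h.not_adj _ (Finset.mem_filter.1 hm).1 (by simp) (by simp)
  · intro hm
    rcases Finset.mem_insert.1 hm with heq | hm
    · exact h.axz_ne_xyz heq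
    · exact h.not_adj _ (Finset.mem_filter.1 hm).1 (by simp) (by simp)

theorem card_triangles (h : IsFlip K K' a x y z) : K'.triangles.card = K.triangles.card := by
  rw [Finset.card_eq_sum_ones, Finset.card_eq_sum_ones, h.sum_eq, h.sum_eq']

theorem card_triOn_side_le (h : IsFlip K K' a x y z) (hK : K.IsBorderedSurface) :
    (K'.triOn {a, x}).card ≤ 2 := by
  have hm : {a, x, y} ∈ K.triOn {a, x} := mem_triOn.2 ⟨h.mem_axy, by grind⟩
  have h2 := hK.card_triOn_le (e := {a, x})
    ⟨Finset.card_pair h.hax, _, mem_triOn.1 hm⟩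
  have hsub : K'.triOn {a, x} ⊆ insert {a, x, z} ((K.triOn {a, x}).erase {a, x, y}) := by
    intro t ht
    rw [mem_triOn, h.mem_iff, Finset.insert_subset_iff, Finset.singleton_subset_iff] at ht
    rw [Finset.mem_insert, Finset.mem_erase, mem_triOn, Finset.insert_subset_iff,
      Finset.singleton_subset_iff]
    obtain ⟨rfl | rfl | ⟨ht, hn⟩, hat, hxt⟩ := ht
    · exact .inl rfl
    · simp [h.hax, h.hay, h.haz] at hat
    · refine .inr ⟨?_, ht, hat, hxt⟩
      rintro rfl
      simp at hn
  have h3 := (Finset.card_le_card hsub).trans (Finset.card_insert_le _ _)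
  rw [Finset.card_erase_of_mem hm] at h3
  omega

theorem card_triOn_le (h : IsFlip K K' a x y z) (hK : K.IsBorderedSurface) {e : Finset V}
    (he : e ∈ K'.edges) : (K'.triOn e).card ≤ 2 := by
  by_cases h1 : e ⊆ {a, x, z} ∨ e ⊆ {x, y, z}
  · obtain ⟨u, v, huv, rfl⟩ := Finset.card_eq_two.1 he.1
    have hd : (K'.triOn {x, z}).card ≤ 2 := by
      refine (Finset.card_le_card (t := {{a, x, z}, {x, y, z}}) fun t ht => ?_).trans
        Finset.card_le_two
      rw [mem_triOn, h.mem_iff, Finset.insert_subset_iff, Finset.singleton_subset_iff] at ht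
      obtain ⟨rfl | rfl | ⟨ht, hn⟩, hxt, hzt⟩ := ht
      · simp
      · simp
      · exact absurd hzt (h.not_adj t ht hxt)
    have e1 := h.card_triOn_side_le hK
    have e2 := h.swap_sides.card_triOn_side_le hK
    have e3 := h.swap_ends.card_triOn_side_le hK
    have e4 := h.swap_ends.swap_sides.card_triOn_side_le hK
    simp only [Finset.insert_subset_iff, Finset.singleton_subset_iff, Finset.mem_insert,
      Finset.mem_singleton] at h1
    have hcases : ({u, v} : Finset V) = {x, z} ∨ ({u, v} : Finset V) = {a, x} ∨
        ({u, v} : Finset V) = {a, z} ∨ ({u, v} : Finset V) = {y, x} ∨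
        ({u, v} : Finset V) = {y, z} := by
      have hc := Finset.pair_comm u v
      rcases h1 with ⟨rfl | rfl | rfl, rfl | rfl | rfl⟩ | ⟨rfl | rfl | rfl, rfl | rfl | rfl⟩ <;>
        simp_all
    rcases hcases with h | h | h | h | h <;> rw [h] <;> assumption
  · rw [not_or] at h1
    have hsub : K'.triOn e ⊆ K.triOn e := by
      intro t ht
      rw [mem_triOn, h.mem_iff] at ht
      obtain ⟨rfl | rfl | ⟨ht, hn⟩, het⟩ := ht
      · exact absurd het h1.1
      · exact absurd het h1.2
      · exact mem_triOn.2 ⟨ht, het⟩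
    refine (Finset.card_le_card hsub).trans (hK.card_triOn_le ?_)
    rw [h.edges_eq] at he
    rcases he with rfl | he
    · exact absurd (by grind) h1.1
    · exact he.1

theorem boundaryEdges_eq (h : IsFlip K K' a x y z) (hK : K.IsBorderedSurface) :
    K'.boundaryEdges = K.boundaryEdges := by
  refine boundaryEdges_eq_of_bd_eq (fun e => hK.card_triOn_le)
    (fun e he => h.card_triOn_le hK he) fun e h2 => ?_
  simp only [bd, triOn, Finset.sum_filter]
  rw [h.sum_eq, h.sum_eq', tetrahedron_boundary h.hax h.hay h.haz h.hxy h.hxz h.hyz h2]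

/-- In the link of `a` the path `x y z` is shortened to the edge `x z`; sending `y` to `x` carries
old paths to new ones. -/
theorem link_end (h : IsFlip K K' a x y z) (hK : K.IsBorderedSurface) {u v : V}
    (hu : K'.graph.Adj a u) (hv : K'.graph.Adj a v) : (K'.link a).Reachable u v := by
  have near : ∀ w, K'.graph.Adj a w → K.graph.Adj a w ∧ w ≠ y := by
    intro w hw
    refine ⟨(h.adj_or hw).resolve_right ?_, ?_⟩
    · rintro (⟨h1, -⟩ | ⟨h1, -⟩)
      exacts [h.hax h1, h.haz h1]
    · rintro rfl
      exact h.not_adj_ends hw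
  have hxz : (K'.link a).Adj x z :=
    ⟨h.hxz, h.hax.symm, h.haz.symm, _, h.axz_mem, by simp, by simp, by simp⟩
  have key := (hK.link_connected a (mem_vertices_of_adj (near u hu).1) u v (near u hu).1
    (near v hv).1).map_of_adj (G' := K'.link a) (fun w => if w = y then x else w) ?_
  · rwa [if_neg (near u hu).2, if_neg (near v hv).2] at key
  · rintro w w' ⟨hne, hwa, hwa', t, ht, hat, hwt, hwt'⟩
    have hay := h.hay
    have hyz := h.hyz
    have hxy := h.hxy
    by_cases hy : y ∈ t
    · rcases h.eq_or_eq t ht hat hy with rfl | rfl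
      · have h1 : (if w = y then x else w) = x := by
          split_ifs with h1
          · rfl
          · simpa [h1, hwa] using hwt
        have h2 : (if w' = y then x else w') = x := by
          split_ifs with h1
          · rfl
          · simpa [h1, hwa'] using hwt'
        rw [h1, h2]
      · simp only [Finset.mem_insert, Finset.mem_singleton, hwa, hwa', false_or] at hwt hwt'
        rcases hwt with rfl | rfl <;> rcases hwt' with rfl | rfl
        · exact absurd rfl hne
        · rw [if_pos rfl, if_neg hne.symm]
          exact hxz.reachable
        · rw [if_pos rfl, if_neg hne]
          exact hxz.reachable.symm
        · exact absurd rfl hne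
    · have h1 : w ≠ y := fun h => hy (h ▸ hwt)
      have h2 : w' ≠ y := fun h => hy (h ▸ hwt')
      rw [if_neg h1, if_neg h2]
      exact SimpleGraph.Adj.reachable
        ⟨hne, hwa, hwa', t, h.mem_of_mem ht fun h => hy h.2, hat, hwt, hwt'⟩

/-- In the link of `x` the edge `a y` is replaced by the path `a z y`. -/
theorem link_side (h : IsFlip K K' a x y z) (hK : K.IsBorderedSurface) {u v : V}
    (hu : K'.graph.Adj x u) (hv : K'.graph.Adj x v) : (K'.link x).Reachable u v := by
  have haz : (K'.link x).Adj a z :=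
    ⟨h.haz, h.hax, h.hxz.symm, _, h.axz_mem, by simp, by simp, by simp⟩
  have hzy : (K'.link x).Adj z y :=
    ⟨h.hyz.symm, h.hxz.symm, h.hxy.symm, _, h.xyz_mem, by simp, by simp, by simp⟩
  have hay := haz.reachable.trans hzy.reachable
  have near : ∀ w, K'.graph.Adj x w → ∃ w₀, K.graph.Adj x w₀ ∧ (K'.link x).Reachable w w₀ := by
    intro w hw
    rcases h.adj_or hw with hw | ⟨-, rfl⟩ | ⟨h1, -⟩
    · exact ⟨w, hw, .rfl⟩
    · exact ⟨a, ⟨h.hax.symm, _, h.mem_axy, by simp, by simp⟩, haz.reachable.symm⟩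
    · exact absurd h1 h.hxz
  obtain ⟨u₀, hu₀, hur⟩ := near u hu
  obtain ⟨v₀, hv₀, hvr⟩ := near v hv
  refine (hur.trans ?_).trans hvr.symm
  refine (hK.link_connected x (mem_vertices_of_adj hu₀) u₀ v₀ hu₀ hv₀).map_of_adj
    (G' := K'.link x) (fun w => w) ?_
  rintro w w' ⟨hne, hwx, hwx', t, ht, hxt, hwt, hwt'⟩
  by_cases hn : a ∈ t ∧ y ∈ t
  · rcases h.eq_or_eq t ht hn.1 hn.2 with rfl | rfl
    · simp only [Finset.mem_insert, Finset.mem_singleton, hwx, hwx', false_or] at hwt hwt'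
      rcases hwt with rfl | rfl <;> rcases hwt' with rfl | rfl
      · exact .rfl
      · exact hay
      · exact hay.symm
      · exact .rfl
    · exact absurd (by simp) (h.not_adj _ ht hxt)
  · exact SimpleGraph.Adj.reachable ⟨hne, hwx, hwx', t, h.mem_of_mem ht hn, hxt, hwt, hwt'⟩

theorem link_other (h : IsFlip K K' a x y z) (hK : K.IsBorderedSurface) {p u v : V}
    (hpa : p ≠ a) (hpx : p ≠ x) (hpy : p ≠ y) (hpz : p ≠ z)
    (hu : K'.graph.Adj p u) (hv : K'.graph.Adj p v) : (K'.link p).Reachable u v := by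
  have near : ∀ w, K'.graph.Adj p w → K.graph.Adj p w := by
    intro w hw
    refine (h.adj_or hw).resolve_right ?_
    rintro (⟨h1, -⟩ | ⟨h1, -⟩)
    exacts [hpx h1, hpz h1]
  refine (hK.link_connected p (mem_vertices_of_adj (near u hu)) u v (near u hu)
    (near v hv)).mono ?_
  rintro w w' ⟨hne, hwp, hwp', t, ht, hpt, hwt, hwt'⟩
  refine ⟨hne, hwp, hwp', t, h.mem_of_mem ht fun hn => ?_, hpt, hwt, hwt'⟩
  rcases h.eq_or_eq t ht hn.1 hn.2 with rfl | rfl <;> simp_all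

/-- A flip turns a disc into a disc. -/
theorem isDisc (h : IsFlip K K' a x y z) (hD : K.IsDisc) : K'.IsDisc := by
  have hK := hD.isBorderedSurface
  refine ⟨fun e he => ?_, fun v _ u w hu hw => ?_, fun u hu v hv => ?_, ?_, ?_⟩
  · rw [ncard_trianglesOn]
    exact h.card_triOn_le hK he
  · by_cases ha : v = a
    · subst ha
      exact h.link_end hK hu hw
    by_cases hx : v = x
    · subst hx
      exact h.link_side hK hu hw
    by_cases hy : v = y
    · subst hy
      exact h.swap_ends.link_end hK hu hw
    by_cases hz : v = z
    · subst hz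
      exact h.swap_sides.link_side hK hu hw
    exact h.link_other hK ha hx hy hz hu hw
  · rw [h.vertices_eq] at hu hv
    have hax : K'.graph.Adj a x := ⟨h.hax, _, h.axz_mem, by simp, by simp⟩
    have hxy : K'.graph.Adj x y := ⟨h.hxy, _, h.xyz_mem, by simp, by simp⟩
    have hay := hax.reachable.trans hxy.reachable
    refine (hK.connected u hu v hv).map_of_adj (G' := K'.graph) (fun w => w) fun p q hpq => ?_
    by_cases h1 : p = a ∧ q = y
    · rw [h1.1, h1.2]
      exact hay
    by_cases h2 : p = y ∧ q = a
    · rw [h2.1, h2.2]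
      exact hay.symm
    exact (h.adj_of_adj hpq h1 h2).reachable
  · rw [h.boundaryEdges_eq hK]
    exact hD.boundary_nonempty
  · have hay : ({a, y} : Finset V) ∈ K.edges :=
      pair_mem_edges.2 ⟨h.hay, _, h.mem_axy, by simp, by simp⟩
    have hfin : K.edges.Finite := K.edgeFinset.finite_toSet.subset fun e he =>
      Finset.mem_coe.2 (mem_edgeFinset.2 he)
    have hnot : ({x, z} : Finset V) ∉ K.edges \ {{a, y}} := fun hm => by
      obtain ⟨-, t, ht, hx, hz⟩ := pair_mem_edges.1 hm.1
      exact h.not_adj t ht hx hz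
    have hcard : K'.edges.ncard = K.edges.ncard := by
      rw [h.edges_eq, Set.ncard_insert_of_notMem hnot hfin.sdiff,
        Set.ncard_sdiff_singleton_add_one hay hfin]
    rw [h.vertices_eq, hcard, h.card_triangles]
    exact hD.euler_char

end IsFlip

end

end TriComplex

/-! ### The flip inequality and the first variation of area -/

theorem sqrt_le_add_div {A s : ℝ} (hA : 0 ≤ A) (hs : 0 < s) : √A ≤ (A + s ^ 2) / (2 * s) := by
  rw [le_div_iff₀ (by positivity)]
  nlinarith [sq_nonneg (√A - s), Real.sq_sqrt hA]

/-- If two angles of a triangle have cotangents `p` and `q`, the third has cotangent `(1 - p q) / (p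
+ q)`, so `h` says that the opposite angles add up to at least `π`. Since `1 - p q = (1 + p²) - p (p
+ q)`, the left side of `h` would be positive if `p₁ + p₂ ≤ 0`. -/
theorem add_pos_of_cot_add_le {p₁ p₂ q₁ q₂ : ℝ} (h₁ : 0 < p₁ + q₁) (h₂ : 0 < p₂ + q₂)
    (h : (1 - p₁ * q₁) * (p₂ + q₂) + (1 - p₂ * q₂) * (p₁ + q₁) ≤ 0) : 0 < p₁ + p₂ := by
  by_contra hn
  have h3 : 0 < (1 + p₁ ^ 2) * (p₂ + q₂) := by positivity
  have h4 : 0 < (1 + p₂ ^ 2) * (p₁ + q₁) := by positivity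
  have h5 : 0 ≤ -(p₁ + p₂) * ((p₁ + q₁) * (p₂ + q₂)) :=
    mul_nonneg (by linarith) (mul_pos h₁ h₂).le
  nlinarith

/-- The cotangents `p₁, p₂` and `q₁, q₂` describe the angles at the two ends of the common edge of
two triangles, and `k = 1 + cos θ` where `θ` is the angle between them. -/
theorem sqrt_add_sqrt_le_of_cot {p₁ p₂ q₁ q₂ k : ℝ} (hk : 0 ≤ k) (h₁ : 0 < p₁ + q₁)
    (h₂ : 0 < p₂ + q₂)
    (h : (1 - p₁ * q₁) * (p₂ + q₂) + (1 - p₂ * q₂) * (p₁ + q₁) ≤ 0)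
    (hA : 0 ≤ (p₁ + p₂) ^ 2 + k * (2 - k - 2 * (p₁ * p₂)))
    (hB : 0 ≤ (q₁ + q₂) ^ 2 + k * (2 - k - 2 * (q₁ * q₂))) :
    √((p₁ + p₂) ^ 2 + k * (2 - k - 2 * (p₁ * p₂))) +
        √((q₁ + q₂) ^ 2 + k * (2 - k - 2 * (q₁ * q₂))) ≤ (p₁ + q₁) + (p₂ + q₂) -
          k ^ 2 * ((p₁ + q₁) + (p₂ + q₂)) / (2 * ((p₁ + p₂) * (q₁ + q₂))) := by
  have hs := add_pos_of_cot_add_le h₁ h₂ h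
  have ht : 0 < q₁ + q₂ := add_pos_of_cot_add_le (p₁ := q₁) (q₁ := p₁) (p₂ := q₂) (q₂ := p₂)
    (by linarith) (by linarith) (by linarith)
  refine (add_le_add (sqrt_le_add_div hA hs) (sqrt_le_add_div hB ht)).trans ?_
  rw [div_add_div _ _ (by positivity) (by positivity), div_le_iff₀ (by positivity)]
  have e : ((p₁ + q₁) + (p₂ + q₂) -
      k ^ 2 * ((p₁ + q₁) + (p₂ + q₂)) / (2 * ((p₁ + p₂) * (q₁ + q₂)))) *
      (2 * (p₁ + p₂) * (2 * (q₁ + q₂))) = 4 * ((p₁ + q₁) + (p₂ + q₂)) * ((p₁ + p₂) * (q₁ + q₂))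
        - 2 * k ^ 2 * ((p₁ + q₁) + (p₂ + q₂)) := by
    field_simp
    ring
  rw [e]
  -- The terms linear in `k` carry `(1 - p₁ p₂)(q₁ + q₂) + (1 - q₁ q₂)(p₁ + p₂)`, which expands to
  -- the same polynomial as the left side of `h`.
  have := mul_nonpos_of_nonneg_of_nonpos hk h
  nlinarith

/-- The area of the parallelogram spanned by `v` and `w`. -/
noncomputable def parArea (v w : Space3) : ℝ :=
  √(inner ℝ v v * inner ℝ w w - inner ℝ v w * inner ℝ v w)

theorem triangleArea_eq_parArea (p q r : Space3) :
    triangleArea p q r = 1 / 2 * parArea (q - p) (r - p) :=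
  triangleArea_eq p q r

theorem parArea_nonneg (v w : Space3) : 0 ≤ parArea v w := Real.sqrt_nonneg _

theorem triangleArea_nonneg (p q r : Space3) : 0 ≤ triangleArea p q r := by
  rw [triangleArea_eq_parArea]
  exact mul_nonneg (by norm_num) (parArea_nonneg _ _)

theorem parArea_comm (v w : Space3) : parArea v w = parArea w v := by
  rw [parArea, parArea, real_inner_comm v w, mul_comm (inner ℝ v v)]

theorem parArea_mul_self (v w : Space3) : parArea v w * parArea v w =
    inner ℝ v v * inner ℝ w w - inner ℝ v w * inner ℝ v w :=
  Real.mul_self_sqrt (sub_nonneg.2 (real_inner_mul_inner_self_le v w))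

theorem parArea_smul_left (r : ℝ) (hr : 0 ≤ r) (v w : Space3) :
    parArea (r • v) w = r * parArea v w := by
  have : parArea (r • v) w = √(r ^ 2 * (inner ℝ v v * inner ℝ w w - inner ℝ v w * inner ℝ v w)) := by
    rw [parArea]
    congr 1
    simp only [real_inner_smul_left, real_inner_smul_right]
    ring
  rw [this, Real.sqrt_mul (sq_nonneg r), Real.sqrt_sq hr, parArea]

theorem parArea_neg_sub (v w : Space3) : parArea (-v) (w - v) = parArea v w := by
  rw [parArea, parArea]
  congr 1
  simp only [inner_neg_left, inner_neg_right, inner_sub_left, inner_sub_right,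
    real_inner_comm v w]
  ring

/-- Cauchy–Schwarz for the components of `x` and `z` orthogonal to `y`: the cosine of the angle
between the two half-planes along `y` is at most 1 in absolute value. -/
theorem abs_inner_perp_le (x y z : Space3) :
    |inner ℝ x z * inner ℝ y y - inner ℝ x y * inner ℝ y z| ≤ parArea x y * parArea y z := by
  by_cases hy : y = 0
  · simp [hy, parArea]
  have hyy : 0 < inner ℝ y y := real_inner_self_pos.2 hy
  refine abs_le_of_sq_le_sq ?_ (mul_nonneg (parArea_nonneg _ _) (parArea_nonneg _ _))
  have h := real_inner_mul_inner_self_le (inner ℝ y y • x - inner ℝ x y • y)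
    (inner ℝ y y • z - inner ℝ y z • y)
  simp only [inner_sub_left, inner_sub_right, real_inner_smul_left, real_inner_smul_right,
    real_inner_comm x y, real_inner_comm y z] at h
  have h1 := parArea_mul_self x y
  have h2 := parArea_mul_self y z
  have e : (parArea x y * parArea y z) ^ 2 =
      (parArea x y * parArea x y) * (parArea y z * parArea y z) := by ring
  rw [e, h1, h2]
  have hy2 : 0 < inner ℝ y y * inner ℝ y y := mul_pos hyy hyy
  refine le_of_mul_le_mul_left ?_ hy2
  nlinarith

/-- If the angles opposite to the common edge of two triangles add up to at least `π`, then
flipping the edge does not increase the area. -/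
theorem parArea_flip_le {x y z : Space3} (h₁ : 0 < parArea x y) (h₂ : 0 < parArea y z)
    (h : (inner ℝ x x - inner ℝ x y) / parArea x y +
      (inner ℝ z z - inner ℝ y z) / parArea y z ≤ 0) :
    parArea x z + parArea (x - y) (z - y) ≤ parArea x y + parArea y z ∧
      (parArea x z + parArea (x - y) (z - y) = parArea x y + parArea y z → 0 < parArea x z) := by
  have hy : 0 < inner ℝ y y := by
    refine real_inner_self_pos.2 ?_
    rintro rfl
    simp [parArea] at h₁
  have e₁ := parArea_mul_self x y
  have e₂ := parArea_mul_self y z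
  have hperp := abs_inner_perp_le x y z
  have hxz : parArea x z = √(inner ℝ x x * inner ℝ z z - inner ℝ x z * inner ℝ x z) := rfl
  have hxyz : parArea (x - y) (z - y) =
      √((inner ℝ x x - 2 * inner ℝ x y + inner ℝ y y) *
        (inner ℝ z z - 2 * inner ℝ y z + inner ℝ y y) -
        (inner ℝ x z - inner ℝ x y - inner ℝ y z + inner ℝ y y) ^ 2) := by
    rw [parArea]
    congr 1
    simp only [inner_sub_left, inner_sub_right, real_inner_comm x y, real_inner_comm z y]
    ring
  have g₁ : 0 ≤ inner ℝ x x * inner ℝ z z - inner ℝ x z * inner ℝ x z :=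
    sub_nonneg.2 (real_inner_mul_inner_self_le x z)
  have g₂ : 0 ≤ (inner ℝ x x - 2 * inner ℝ x y + inner ℝ y y) *
        (inner ℝ z z - 2 * inner ℝ y z + inner ℝ y y) -
        (inner ℝ x z - inner ℝ x y - inner ℝ y z + inner ℝ y y) ^ 2 := by
    have := real_inner_mul_inner_self_le (x - y) (z - y)
    simp only [inner_sub_left, inner_sub_right, real_inner_comm x y, real_inner_comm y z] at this
    linarith
  rw [hxyz, hxz]
  generalize parArea x y = D₁ at *
  generalize parArea y z = D₂ at *
  generalize inner ℝ x x = xx at *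
  generalize inner ℝ y y = yy at *
  generalize inner ℝ z z = zz at *
  generalize inner ℝ x y = xy at *
  generalize inner ℝ y z = yz at *
  generalize inner ℝ x z = xz at *
  clear hxz hxyz
  have hN : 0 < D₁ * D₂ / yy := by positivity
  -- With `a` as origin, `p₁`, `p₂` are the cotangents of the angles at `a`, and `q₁`, `q₂` those at
  -- `y`. The number `k` vanishes exactly when the two triangles unfold flat on opposite sides of
  -- their edge. All areas scale by `D₁ * D₂ / yy`.
  set p₁ := xy / D₁ with hp₁
  set p₂ := yz / D₂ with hp₂
  set q₁ := (yy - xy) / D₁ with hq₁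
  set q₂ := (yy - yz) / D₂ with hq₂
  set k := 1 + (xz * yy - xy * yz) / (D₁ * D₂) with hk
  have s₁ : p₁ + q₁ = yy / D₁ := by rw [hp₁, hq₁]; ring
  have s₂ : p₂ + q₂ = yy / D₂ := by rw [hp₂, hq₂]; ring
  have hk0 : 0 ≤ k := by
    have := (abs_le.1 hperp).1
    have : -1 ≤ (xz * yy - xy * yz) / (D₁ * D₂) := by
      rw [le_div_iff₀ (by positivity)]
      linarith
    linarith
  have r₁ : 1 - p₁ * q₁ = yy * (xx - xy) / D₁ ^ 2 := by
    rw [hp₁, hq₁, eq_div_iff (by positivity)]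
    field_simp
    linear_combination e₁
  have r₂ : 1 - p₂ * q₂ = yy * (zz - yz) / D₂ ^ 2 := by
    rw [hp₂, hq₂, eq_div_iff (by positivity)]
    field_simp
    linear_combination e₂
  have hcot : (1 - p₁ * q₁) * (p₂ + q₂) + (1 - p₂ * q₂) * (p₁ + q₁) ≤ 0 := by
    have : (1 - p₁ * q₁) * (p₂ + q₂) + (1 - p₂ * q₂) * (p₁ + q₁) =
        yy ^ 2 / (D₁ * D₂) * ((xx - xy) / D₁ + (zz - yz) / D₂) := by
      rw [r₁, r₂, s₁, s₂]
      field_simp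
    rw [this]
    exact mul_nonpos_of_nonneg_of_nonpos (by positivity) h
  have a₁ : xx * zz - xz * xz =
      (D₁ * D₂ / yy) ^ 2 * ((p₁ + p₂) ^ 2 + k * (2 - k - 2 * (p₁ * p₂))) := by
    have : (D₁ * D₂ / yy) ^ 2 * ((p₁ + p₂) ^ 2 + k * (2 - k - 2 * (p₁ * p₂))) =
        (xy ^ 2 * (D₂ * D₂) + yz ^ 2 * (D₁ * D₁) - 2 * (xy * yz) * (xz * yy - xy * yz) +
          (D₁ * D₁) * (D₂ * D₂) - (xz * yy - xy * yz) ^ 2) / yy ^ 2 := by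
      rw [hp₁, hp₂, hk]
      field_simp
      ring
    rw [this, e₁, e₂]
    field_simp
    ring
  have a₂ : (xx - 2 * xy + yy) * (zz - 2 * yz + yy) - (xz - xy - yz + yy) ^ 2 =
      (D₁ * D₂ / yy) ^ 2 * ((q₁ + q₂) ^ 2 + k * (2 - k - 2 * (q₁ * q₂))) := by
    have : (D₁ * D₂ / yy) ^ 2 * ((q₁ + q₂) ^ 2 + k * (2 - k - 2 * (q₁ * q₂))) =
        ((yy - xy) ^ 2 * (D₂ * D₂) + (yy - yz) ^ 2 * (D₁ * D₁) -
          2 * ((yy - xy) * (yy - yz)) * (xz * yy - xy * yz) +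
          (D₁ * D₁) * (D₂ * D₂) - (xz * yy - xy * yz) ^ 2) / yy ^ 2 := by
      rw [hq₁, hq₂, hk]
      field_simp
      ring
    rw [this, e₁, e₂]
    field_simp
    ring
  have hs₁ : 0 < p₁ + q₁ := by rw [s₁]; positivity
  have hs₂ : 0 < p₂ + q₂ := by rw [s₂]; positivity
  have hs := add_pos_of_cot_add_le hs₁ hs₂ hcot
  have ht : 0 < q₁ + q₂ := add_pos_of_cot_add_le (p₁ := q₁) (q₁ := p₁) (p₂ := q₂) (q₂ := p₂)
    (by linarith) (by linarith) (by linarith)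
  rw [a₁] at g₁ ⊢
  rw [a₂] at g₂ ⊢
  have main := sqrt_add_sqrt_le_of_cot hk0 hs₁ hs₂ hcot
    (nonneg_of_mul_nonneg_right g₁ (by positivity))
    (nonneg_of_mul_nonneg_right g₂ (by positivity))
  rw [Real.sqrt_mul (sq_nonneg _), Real.sqrt_mul (sq_nonneg _), Real.sqrt_sq hN.le, ← mul_add]
  have hD : D₁ + D₂ = D₁ * D₂ / yy * ((p₁ + q₁) + (p₂ + q₂)) := by
    rw [s₁, s₂]
    field_simp
    ring
  have hnn : 0 ≤ k ^ 2 * ((p₁ + q₁) + (p₂ + q₂)) / (2 * ((p₁ + p₂) * (q₁ + q₂))) := by positivity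
  rw [hD]
  refine ⟨mul_le_mul_of_nonneg_left (by linarith) hN.le, fun heq => ?_⟩
  have heq := mul_left_cancel₀ hN.ne' heq
  -- The inequality loses a positive multiple of `k ^ 2`, so equality forces the flat position,
  -- where the area for `x`, `z` is a positive multiple of `p₁ + p₂`.
  have hk0 : k = 0 := by
    by_contra hne
    have : 0 < k ^ 2 * ((p₁ + q₁) + (p₂ + q₂)) / (2 * ((p₁ + p₂) * (q₁ + q₂))) := by positivity
    linarith
  rw [hk0, zero_mul, add_zero, Real.sqrt_sq hs.le]
  positivity

theorem exists_smul_of_parArea_eq_zero {u v w : Space3} (hv : 0 < inner ℝ u v)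
    (hw : 0 < inner ℝ u w) (h : parArea v w = 0) : ∃ r : ℝ, 0 < r ∧ w = r • v := by
  have hv0 : v ≠ 0 := by
    rintro rfl
    simp at hv
  have hvv : 0 < inner ℝ v v := real_inner_self_pos.2 hv0
  have h1 := parArea_mul_self v w
  rw [h, zero_mul] at h1
  have h2 : inner ℝ v v • w - inner ℝ v w • v = 0 := by
    rw [← inner_self_eq_zero (𝕜 := ℝ)]
    simp only [inner_sub_left, inner_sub_right, real_inner_smul_left, real_inner_smul_right,
      real_inner_comm v w]
    linear_combination (-inner ℝ v v) * h1
  have h3 : w = (inner ℝ v w / inner ℝ v v) • v := by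
    rw [div_eq_inv_mul, mul_smul, ← sub_eq_zero.1 h2, smul_smul, inv_mul_cancel₀ hvv.ne', one_smul]
  refine ⟨_, ?_, h3⟩
  rw [h3, real_inner_smul_right] at hw
  exact pos_of_mul_pos_left hw hv.le

/-- The derivative of the area of a triangle when one vertex moves with velocity `u`. -/
theorem hasDerivAt_triangleArea {a q r : Space3} (u : Space3)
    (h : 0 < parArea (q - a) (r - a)) :
    HasDerivAt (fun s : ℝ => triangleArea (a + s • u) q r)
      (-(inner ℝ u (q - a) * (inner ℝ (r - a) (r - a) - inner ℝ (q - a) (r - a)) +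
        inner ℝ u (r - a) * (inner ℝ (q - a) (q - a) - inner ℝ (q - a) (r - a))) /
        (2 * parArea (q - a) (r - a))) 0 := by
  have e : (fun s : ℝ => triangleArea (a + s • u) q r) = fun s => 1 / 2 *
      √((inner ℝ (q - a) (q - a) - 2 * s * inner ℝ u (q - a) + s * s * inner ℝ u u) *
        (inner ℝ (r - a) (r - a) - 2 * s * inner ℝ u (r - a) + s * s * inner ℝ u u) -
        (inner ℝ (q - a) (r - a) - s * (inner ℝ u (q - a) + inner ℝ u (r - a)) +
          s * s * inner ℝ u u) ^ 2) := by
    ext s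
    rw [triangleArea_eq]
    congr 2
    rw [← sub_sub, ← sub_sub]
    generalize q - a = v
    generalize r - a = w
    simp only [inner_sub_left, inner_sub_right, real_inner_smul_left, real_inner_smul_right,
      real_inner_comm u v, real_inner_comm u w]
    ring
  rw [e]
  have hD := parArea_mul_self (q - a) (r - a)
  have hpar : parArea (q - a) (r - a) = √(inner ℝ (q - a) (q - a) * inner ℝ (r - a) (r - a) -
    inner ℝ (q - a) (r - a) * inner ℝ (q - a) (r - a)) := rfl
  generalize parArea (q - a) (r - a) = D at *
  generalize inner ℝ (q - a) (q - a) = A at *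
  generalize inner ℝ (r - a) (r - a) = B at *
  generalize inner ℝ (q - a) (r - a) = C at *
  generalize inner ℝ u (q - a) = b at *
  generalize inner ℝ u (r - a) = c at *
  generalize inner ℝ u u = m at *
  have hid := hasDerivAt_id (0 : ℝ)
  have h1 : ∀ A b : ℝ, HasDerivAt (fun s : ℝ => A - 2 * s * b + s * s * m) (-(2 * b)) 0 := by
    intro A b
    have := (((hid.const_mul 2).mul_const b).const_sub A).add ((hid.mul hid).mul_const m)
    exact this.congr_deriv (by simp)
  have h2 : HasDerivAt (fun s : ℝ => C - s * (b + c) + s * s * m) (-(b + c)) 0 := by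
    have := ((hid.mul_const (b + c)).const_sub C).add ((hid.mul hid).mul_const m)
    exact this.congr_deriv (by simp)
  have h3 := ((h1 A b).mul (h1 B c)).sub (h2.pow 2)
  have h4 := (h3.sqrt (by simp; nlinarith)).const_mul (1 / 2)
  refine HasDerivAt.congr_deriv h4 ?_
  have hz : √((A - 2 * 0 * b + 0 * 0 * m) * (B - 2 * 0 * c + 0 * 0 * m) -
      (C - 0 * (b + c) + 0 * 0 * m) ^ 2) = D := by
    rw [hpar]
    congr 1
    ring
  simp only [Pi.mul_apply, Pi.sub_apply, Pi.pow_apply]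
  rw [hz]
  field_simp
  simp
  ring

/-! ### Fillings and interior edges of a disc -/

namespace TriComplex

variable {V : Type} [DecidableEq V] {K : TriComplex V}

/-- Every triangle of edges in a disc bounds a chain of triangles. -/
theorem IsDisc.exists_fills (hD : K.IsDisc) {t₀ : Finset V} (h3 : t₀.card = 3)
    (he : ∀ e ⊆ t₀, e.card = 2 → e ∈ K.edges) : ∃ c, K.Fills c t₀ := by
  obtain ⟨c, hc⟩ := hD.isBorderedSurface.euler_char_iff.1 hD.euler_char
    (fun e => if e ⊆ t₀ then 1 else 0) fun v _ => by
      rw [vbd, ← Finset.sum_filter, Finset.filter_filter,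
        ← sum_powersetCard_two_eq_zero h3 v]
      congr 1
      ext e
      simp only [Finset.mem_filter, mem_edgeFinset, Finset.mem_powersetCard]
      exact ⟨fun h => ⟨⟨h.2.2, h.1.1⟩, h.2.1⟩, fun h => ⟨he e h.1.1 h.1.2, h.2, h.1.1⟩⟩
  exact ⟨c, h3, he, hc⟩

/-- An interior edge lies in exactly two triangles. -/
theorem exists_opposite (hK : K.IsBorderedSurface) {a x y : V} (ha : a ∈ K.interiorVertices)
    (hax : a ≠ x) (hay : a ≠ y) (hxy : x ≠ y) (ht : {a, x, y} ∈ K.triangles) :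
    ∃ z, z ≠ a ∧ z ≠ x ∧ z ≠ y ∧ {a, y, z} ∈ K.triangles ∧
      K.triOn {a, y} = {{a, x, y}, {a, y, z}} ∧ ({a, x, y} : Finset V) ≠ {a, y, z} := by
  have hm : {a, x, y} ∈ K.triOn {a, y} := mem_triOn.2 ⟨ht, by grind⟩
  have he : {a, y} ∈ K.edges := ⟨Finset.card_pair hay, _, mem_triOn.1 hm⟩
  have h1 : (K.triOn {a, y}).card ≠ 1 := by
    intro h1
    rw [← ncard_trianglesOn] at h1
    exact ha.2 _ ⟨he, h1⟩ (by simp)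
  have h2 : 1 < (K.triOn {a, y}).card :=
    lt_of_le_of_ne (Finset.card_pos.2 ⟨_, hm⟩) h1.symm
  obtain ⟨s, hs, hne⟩ := Finset.exists_mem_ne h2 {a, x, y}
  have heq := triOn_eq_pair (hK.card_triOn_le he) hm hs hne.symm
  rw [mem_triOn, Finset.insert_subset_iff, Finset.singleton_subset_iff] at hs
  obtain ⟨z, hza, hzy, rfl⟩ := Finset.exists_eq_of_card_eq_three (K.card_eq_three s hs.1)
    hs.2.1 hs.2.2 hay
  refine ⟨z, hza, ?_, hzy, hs.1, heq, hne.symm⟩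
  rintro rfl
  exact hne (by rw [Finset.pair_comm])

end TriComplex

/-! ### Existence of a flip site -/

namespace PolyhedralDisc

open TriComplex

theorem SameBoundary.trans {V W X : Type} {F : PolyhedralDisc V} {G : PolyhedralDisc W}
    {H : PolyhedralDisc X} (h₁ : F.SameBoundary G) (h₂ : G.SameBoundary H) : F.SameBoundary H := by
  obtain ⟨φ, hφ⟩ := h₁
  obtain ⟨ψ, hψ⟩ := h₂
  exact ⟨φ.trans ψ, fun w => (hψ (φ w)).trans (hφ w)⟩

theorem sameBoundary_of_boundaryEdges_eq {V : Type} {F G : PolyhedralDisc V}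
    (hb : G.complex.boundaryEdges = F.complex.boundaryEdges)
    (hpos : ∀ e ∈ F.complex.boundaryEdges, ∀ v ∈ e, G.pos v = F.pos v) : F.SameBoundary G := by
  have hr : F.complex.boundaryRealization = G.complex.boundaryRealization := by
    simp only [boundaryRealization, hb]
  refine ⟨Homeomorph.setCongr hr, fun ⟨w, e, he, _, h0, _⟩ => ?_⟩
  refine finsum_congr fun v => ?_
  change w v • G.pos v = w v • F.pos v
  by_cases hv : v ∈ e
  · rw [hpos e he v hv]
  · rw [h0 v hv, zero_smul, zero_smul]

theorem IsAreaMinimizing.of_sameBoundary {V : Type} {n : ℕ} {F G : PolyhedralDisc V}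
    (hF : F.IsAreaMinimizing n) (hFG : F.SameBoundary G) (hn : G.complex.triangles.card ≤ n)
    (hA : G.area ≤ F.area) : G.IsAreaMinimizing n :=
  ⟨hn, fun W H hH hHn => hA.trans (hF.2 W H (hFG.trans hH) hHn)⟩

theorem faceArea_nonneg {V : Type} (F : PolyhedralDisc V) (t : Finset V) : 0 ≤ F.faceArea t :=
  mul_nonneg (by norm_num) <| Finset.sum_nonneg fun _ _ => Finset.sum_nonneg fun _ _ =>
    Finset.sum_nonneg fun _ _ => triangleArea_nonneg _ _ _

variable {V : Type} [DecidableEq V]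

theorem faceArea_pos_of_nondegenerateOn {F : PolyhedralDisc V} {t : Finset V} (h3 : t.card = 3)
    (h : F.NondegenerateOn t) : 0 < F.faceArea t := by
  obtain ⟨p, q, r, hpq, hpr, hqr, rfl⟩ := Finset.card_eq_three.1 h3
  refine lt_of_le_of_ne (F.faceArea_nonneg _) fun h0 => h ?_
  rw [F.faceArea_eq hpq hpr hqr, triangleArea] at h0
  have h1 : ((F.pos '' (({p, q, r} : Finset V) : Set V))) = {F.pos q, F.pos p, F.pos r} := by
    simp only [Finset.coe_insert, Finset.coe_singleton, Set.image_insert_eq, Set.image_singleton]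
    rw [Set.insert_comm]
  rw [h1, EuclideanGeometry.collinear_iff_eq_or_eq_or_sin_eq_zero]
  have h2 := h0.symm
  simp only [mul_eq_zero, dist_eq_zero] at h2
  rcases h2 with ((h2 | h2) | h2) | h2
  · norm_num at h2
  · exact .inl h2.symm
  · exact .inr (.inl h2.symm)
  · exact .inr (.inr h2)

/-- An area minimizing disc together with an interior vertex `a` at which it is not saddle and
at which some triangle has positive area. -/
structure NonSaddle (n : ℕ) (F : PolyhedralDisc V) (a : V) : Prop where
  minimizing : F.IsAreaMinimizing n
  interior : a ∈ F.complex.interiorVertices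
  halfSpace : ∃ u : Space3, ∀ b, F.complex.graph.Adj a b → 0 < inner ℝ u (F.pos b - F.pos a)
  exists_pos : ∃ t ∈ F.complex.triangles, a ∈ t ∧ 0 < F.faceArea t

/-- Flipping the edge `a y` of the triangles `a x y` and `a y z` does not increase the area, and
`a x z` is degenerate after an area preserving flip only if `a x y` and `a y z` are degenerate. -/
structure FlipSite (F : PolyhedralDisc V) (a x y z : V) : Prop where
  hax : a ≠ x
  hay : a ≠ y
  haz : a ≠ z
  hxy : x ≠ y
  hxz : x ≠ z
  hyz : y ≠ z
  mem_axy : {a, x, y} ∈ F.complex.triangles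
  mem_ayz : {a, y, z} ∈ F.complex.triangles
  triOn_eq : F.complex.triOn {a, y} = {{a, x, y}, {a, y, z}}
  axy_ne_ayz : ({a, x, y} : Finset V) ≠ {a, y, z}
  area_le : F.faceArea {a, x, z} + F.faceArea {x, y, z} ≤
    F.faceArea {a, x, y} + F.faceArea {a, y, z}
  area_eq_zero : F.faceArea {a, x, z} + F.faceArea {x, y, z} =
    F.faceArea {a, x, y} + F.faceArea {a, y, z} → F.faceArea {a, x, z} = 0 →
    F.faceArea {a, x, y} = 0 ∧ F.faceArea {a, y, z} = 0

theorem faceArea_eq_parArea (F : PolyhedralDisc V) {a b c : V} (hab : a ≠ b) (hac : a ≠ c)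
    (hbc : b ≠ c) :
    F.faceArea {a, b, c} = 1 / 2 * parArea (F.pos b - F.pos a) (F.pos c - F.pos a) := by
  rw [F.faceArea_eq hab hac hbc, triangleArea_eq_parArea]

theorem faceArea_eq_parArea_sub (F : PolyhedralDisc V) {x y z : V} (a : V) (hxy : x ≠ y)
    (hxz : x ≠ z) (hyz : y ≠ z) : F.faceArea {x, y, z} = 1 / 2 *
      parArea ((F.pos x - F.pos a) - (F.pos y - F.pos a))
        ((F.pos z - F.pos a) - (F.pos y - F.pos a)) := by
  rw [F.faceArea_eq hxy hxz hyz, triangleArea_rotate, triangleArea_eq_parArea,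
    sub_sub_sub_cancel_right, sub_sub_sub_cancel_right]

namespace NonSaddle

variable {n : ℕ} {F : PolyhedralDisc V} {a : V}

/-- Next to a degenerate triangle the farther vertex gives a flip site. -/
theorem exists_flipSite_of_smul (h : F.NonSaddle n a) {x y : V} (hax : a ≠ x) (hay : a ≠ y)
    (hxy : x ≠ y) (ht : {a, x, y} ∈ F.complex.triangles) {r : ℝ} (hr : 0 < r) (hr1 : r ≤ 1)
    (hrx : F.pos x - F.pos a = r • (F.pos y - F.pos a)) : ∃ x y z, F.FlipSite a x y z := by
  obtain ⟨z, hza, hzx, hzy, hz, htri, hne⟩ :=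
    exists_opposite F.isDisc.isBorderedSurface h.interior hax hay hxy ht
  -- The image of `x` lies on the segment from `a` to `y`, so the new triangles divide the image of
  -- `a y z` in the ratio `r : 1 - r`.
  have e₁ : F.faceArea {a, x, z} = r * F.faceArea {a, y, z} := by
    rw [F.faceArea_eq_parArea hax hza.symm hzx.symm, F.faceArea_eq_parArea hay hza.symm hzy.symm,
      hrx, parArea_smul_left r hr.le]
    ring
  have e₂ : F.faceArea {x, y, z} = (1 - r) * F.faceArea {a, y, z} := by
    rw [F.faceArea_eq_parArea_sub a hxy hzx.symm hzy.symm,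
      F.faceArea_eq_parArea hay hza.symm hzy.symm, hrx,
      ← parArea_neg_sub (F.pos y - F.pos a) (F.pos z - F.pos a)]
    have : r • (F.pos y - F.pos a) - (F.pos y - F.pos a) = (1 - r) • -(F.pos y - F.pos a) := by
      module
    rw [this, parArea_smul_left _ (by linarith)]
    ring
  have e₃ : F.faceArea {a, x, y} = 0 := by
    rw [F.faceArea_eq_parArea hax hay hxy, hrx, parArea_smul_left _ hr.le]
    simp [parArea]
  refine ⟨x, y, z, hax, hay, hza.symm, hxy, hzx.symm, hzy.symm, ht, hz, htri, hne, ?_, ?_⟩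
  · rw [e₁, e₂, e₃]
    linarith
  · intro _ h0
    rw [e₁] at h0
    exact ⟨e₃, (mul_eq_zero.1 h0).resolve_left hr.ne'⟩

/-- The derivative of the area as the vertex `a` moves with velocity `u`, in the case that all
triangles at `a` are nondegenerate. -/
theorem sum_cot_eq_zero (h : F.NonSaddle n a)
    (hpos : ∀ t ∈ F.complex.triangles, a ∈ t → 0 < F.faceArea t) (u : Space3) :
    ∑ t ∈ F.complex.triangles with a ∈ t, ∑ y ∈ t.erase a, ∑ x ∈ (t.erase a).erase y,
      inner ℝ u (F.pos y - F.pos a) * ((inner ℝ (F.pos x - F.pos a) (F.pos x - F.pos a) -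
        inner ℝ (F.pos x - F.pos a) (F.pos y - F.pos a)) /
        parArea (F.pos x - F.pos a) (F.pos y - F.pos a)) = 0 := by
  set g : V → V → ℝ := fun x y =>
    inner ℝ u (F.pos y - F.pos a) * ((inner ℝ (F.pos x - F.pos a) (F.pos x - F.pos a) -
        inner ℝ (F.pos x - F.pos a) (F.pos y - F.pos a)) /
        parArea (F.pos x - F.pos a) (F.pos y - F.pos a)) with hg
  -- Moving the interior vertex `a` alone keeps the boundary curve and the triangle count, so `s =
  -- 0` minimizes the area of this family.
  let G : ℝ → PolyhedralDisc V := fun s =>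
    ⟨F.complex, F.isDisc, Function.update F.pos a (F.pos a + s • u)⟩
  have hG0 : (G 0).area = F.area := by
    simp [G, area, faceArea]
  have hmin : ∀ s, (G 0).area ≤ (G s).area := by
    intro s
    rw [hG0]
    refine h.minimizing.2 V (G s) (sameBoundary_of_boundaryEdges_eq rfl fun e he v hv => ?_)
      h.minimizing.1
    refine Function.update_of_ne ?_ _ _
    rintro rfl
    exact h.interior.2 e he hv
  have hderiv : ∀ t ∈ F.complex.triangles, HasDerivAt (fun s => (G s).faceArea t)
      (if a ∈ t then -(1 / 2) * ∑ y ∈ t.erase a, ∑ x ∈ (t.erase a).erase y, g x y else 0) 0 := by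
    intro t ht
    by_cases hat : a ∈ t
    · rw [if_pos hat]
      obtain ⟨q, hq, haq⟩ := exists_adj_of_mem ht hat
      obtain ⟨r, hra, hrq, rfl⟩ := Finset.exists_eq_of_card_eq_three
        (F.complex.card_eq_three t ht) hat hq haq.1
      have hqa := haq.1
      have hA := hpos _ ht hat
      rw [F.faceArea_eq_parArea haq.1 hra.symm hrq.symm] at hA
      have hd := hasDerivAt_triangleArea u (pos_of_mul_pos_right hA (by norm_num))
      have e : (fun s => (G s).faceArea {a, q, r}) =
          fun s => triangleArea (F.pos a + s • u) (F.pos q) (F.pos r) := by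
        ext s
        rw [(G s).faceArea_eq haq.1 hra.symm hrq.symm]
        simp [G, hra, hqa.symm]
      rw [e]
      refine hd.congr_deriv ?_
      have e1 : ({a, q, r} : Finset V).erase a = {q, r} := by grind
      have e2 : ({q, r} : Finset V).erase q = {r} := by grind
      have e3 : ({q, r} : Finset V).erase r = {q} := by grind
      rw [e1, Finset.sum_pair hrq.symm, e2, e3, Finset.sum_singleton, Finset.sum_singleton]
      have hsymm : parArea (F.pos r - F.pos a) (F.pos q - F.pos a) =
          parArea (F.pos q - F.pos a) (F.pos r - F.pos a) := parArea_comm _ _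
      simp only [hg]
      rw [hsymm, real_inner_comm (F.pos q - F.pos a) (F.pos r - F.pos a)]
      ring
    · rw [if_neg hat]
      have e : (fun s => (G s).faceArea t) = fun _ => F.faceArea t := by
        ext s
        have hp : ∀ v ∈ t, (G s).pos v = F.pos v := fun v hv =>
          Function.update_of_ne (by rintro rfl; exact hat hv) _ _
        simp only [faceArea]
        congr 1
        refine Finset.sum_congr rfl fun p hp' => Finset.sum_congr rfl fun q hq' =>
          Finset.sum_congr rfl fun r hr' => ?_
        rw [hp p hp', hp q hq', hp r hr']
      rw [e]
      exact hasDerivAt_const _ _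
  have hsum : HasDerivAt (fun s => (G s).area) _ 0 := HasDerivAt.fun_sum hderiv
  have hzero := IsLocalMin.hasDerivAt_eq_zero (Filter.Eventually.of_forall hmin) hsum
  rw [← Finset.sum_filter, ← Finset.mul_sum] at hzero
  exact (mul_eq_zero.1 hzero).resolve_left (by norm_num)

/-- The half-space condition makes every weight `⟪u, y - a⟫` positive, so in a vanishing sum some
edge has a nonpositive sum of opposite cotangents. -/
theorem exists_flipSite_of_pos (h : F.NonSaddle n a)
    (hpos : ∀ t ∈ F.complex.triangles, a ∈ t → 0 < F.faceArea t) :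
    ∃ x y z, F.FlipSite a x y z := by
  have hK := F.isDisc.isBorderedSurface
  obtain ⟨u, hu⟩ := h.halfSpace
  set g : V → V → ℝ := fun x y =>
    inner ℝ u (F.pos y - F.pos a) * ((inner ℝ (F.pos x - F.pos a) (F.pos x - F.pos a) -
        inner ℝ (F.pos x - F.pos a) (F.pos y - F.pos a)) /
        parArea (F.pos x - F.pos a) (F.pos y - F.pos a)) with hg
  -- The first variation regrouped by edges `a y` instead of by triangles.
  have hsum : ∑ y ∈ F.complex.vertexFinset.erase a, ∑ t ∈ F.complex.triOn {a, y},
      ∑ x ∈ (t.erase a).erase y, g x y = 0 := by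
    rw [← h.sum_cot_eq_zero hpos u]
    refine Finset.sum_comm' fun y t => ?_
    simp only [Finset.mem_erase, mem_vertexFinset, mem_triOn, Finset.mem_filter,
      Finset.insert_subset_iff, Finset.singleton_subset_iff]
    exact ⟨fun h => ⟨⟨h.1.1, h.2.2.2⟩, h.2.1, h.2.2.1⟩,
      fun h => ⟨⟨h.1.1, t, h.2.1, h.1.2⟩, h.2.1, h.2.2, h.1.2⟩⟩
  obtain ⟨y, hay, hy⟩ : ∃ y, F.complex.graph.Adj a y ∧
      ∑ t ∈ F.complex.triOn {a, y}, ∑ x ∈ (t.erase a).erase y, g x y ≤ 0 := by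
    by_contra! hcon
    refine hsum.not_gt (Finset.sum_pos' (fun y hy => ?_) ?_)
    · by_cases hay : F.complex.graph.Adj a y
      · exact (hcon y hay).le
      · refine (Finset.sum_eq_zero fun t ht => ?_).ge
        rw [mem_triOn, Finset.insert_subset_iff, Finset.singleton_subset_iff] at ht
        exact absurd ⟨(Finset.ne_of_mem_erase hy).symm, t, ht⟩ hay
    · obtain ⟨t, ht, hat⟩ := h.interior.1
      obtain ⟨y, hy, hay⟩ := exists_adj_of_mem ht hat
      exact ⟨y, Finset.mem_erase.2 ⟨hay.1.symm, mem_vertexFinset.2 ⟨t, ht, hy⟩⟩, hcon y hay⟩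
  obtain ⟨hne, t, ht, hat, hyt⟩ := id hay
  obtain ⟨x, hxa, hxy, rfl⟩ := Finset.exists_eq_of_card_eq_three
    (F.complex.card_eq_three t ht) hat hyt hne
  rw [Finset.pair_comm] at ht
  obtain ⟨z, hza, hzx, hzy, hz, htri, hne'⟩ := exists_opposite hK h.interior hxa.symm hne hxy ht
  rw [htri, Finset.sum_pair hne'] at hy
  have e1 : (({a, x, y} : Finset V).erase a).erase y = {x} := by grind
  have e2 : (({a, y, z} : Finset V).erase a).erase y = {z} := by grind
  rw [e1, e2, Finset.sum_singleton, Finset.sum_singleton] at hy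
  have p₁ := hpos _ ht (by simp)
  have p₂ := hpos _ hz (by simp)
  rw [F.faceArea_eq_parArea hxa.symm hne hxy] at p₁
  rw [F.faceArea_eq_parArea hne hza.symm hzy.symm] at p₂
  have p₁' := pos_of_mul_pos_right p₁ (by norm_num)
  have p₂' := pos_of_mul_pos_right p₂ (by norm_num)
  have hsymm : parArea (F.pos z - F.pos a) (F.pos y - F.pos a) =
      parArea (F.pos y - F.pos a) (F.pos z - F.pos a) := parArea_comm _ _
  simp only [hg] at hy
  rw [← mul_add, hsymm, real_inner_comm (F.pos y - F.pos a) (F.pos z - F.pos a)] at hy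
  obtain ⟨m₁, m₂⟩ := parArea_flip_le p₁' p₂' (nonpos_of_mul_nonpos_right hy (hu y hay))
  have f₁ := F.faceArea_eq_parArea hxa.symm hne hxy
  have f₂ := F.faceArea_eq_parArea hne hza.symm hzy.symm
  have f₃ := F.faceArea_eq_parArea hxa.symm hza.symm hzx.symm
  have f₄ := F.faceArea_eq_parArea_sub a hxy hzx.symm hzy.symm
  refine ⟨x, y, z, hxa.symm, hne, hza.symm, hxy, hzx.symm, hzy.symm, ht, hz, htri, hne', ?_, ?_⟩
  · rw [f₁, f₂, f₃, f₄]
    linarith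
  · rw [f₁, f₂, f₃, f₄]
    intro heq h0
    have := m₂ (by linarith)
    linarith

theorem exists_flipSite (h : F.NonSaddle n a) : ∃ x y z, F.FlipSite a x y z := by
  by_cases hpos : ∀ t ∈ F.complex.triangles, a ∈ t → 0 < F.faceArea t
  · exact h.exists_flipSite_of_pos hpos
  · push Not at hpos
    obtain ⟨t, ht, hat, h0⟩ := hpos
    obtain ⟨x, hx, hax⟩ := exists_adj_of_mem ht hat
    obtain ⟨y, hya, hyx, rfl⟩ := Finset.exists_eq_of_card_eq_three
      (F.complex.card_eq_three t ht) hat hx hax.1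
    rw [F.faceArea_eq_parArea hax.1 hya.symm hyx.symm] at h0
    obtain ⟨u, hu⟩ := h.halfSpace
    obtain ⟨r, hr, hry⟩ := exists_smul_of_parArea_eq_zero (hu x hax)
      (hu y ⟨hya.symm, _, ht, hat, by simp⟩)
      (le_antisymm (by linarith) (parArea_nonneg _ _))
    rcases le_total r 1 with hr1 | hr1
    · rw [Finset.pair_comm] at ht
      exact h.exists_flipSite_of_smul hya.symm hax.1 hyx ht hr hr1 hry
    · refine h.exists_flipSite_of_smul hax.1 hya.symm hyx.symm ht (inv_pos.2 hr)
        (inv_le_one_of_one_le₀ hr1) ?_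
      rw [hry, smul_smul, inv_mul_cancel₀ hr.ne', one_smul]

omit [DecidableEq V] in
-- The positions are unchanged, so the half-space condition survives as long as no new edge at `a`
-- appears.
theorem replace (h : F.NonSaddle n a) {K' : TriComplex V} (hD : K'.IsDisc)
    (hb : K'.boundaryEdges = F.complex.boundaryEdges)
    (hcard : K'.triangles.card ≤ F.complex.triangles.card)
    (harea : ∑ t ∈ K'.triangles, F.faceArea t ≤ F.area)
    (hadj : ∀ b, K'.graph.Adj a b → F.complex.graph.Adj a b)
    (hpos : ∃ t ∈ K'.triangles, a ∈ t ∧ 0 < F.faceArea t) :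
    NonSaddle n (⟨K', hD, F.pos⟩ : PolyhedralDisc V) a where
  minimizing := h.minimizing.of_sameBoundary (sameBoundary_of_boundaryEdges_eq hb fun _ _ _ _ => rfl)
    (hcard.trans h.minimizing.1) harea
  interior := by
    obtain ⟨t, ht, hat, -⟩ := hpos
    refine ⟨⟨t, ht, hat⟩, ?_⟩
    change ∀ e ∈ K'.boundaryEdges, a ∉ e
    rw [hb]
    exact h.interior.2
  halfSpace := h.halfSpace.imp fun u hu b hab => hu b (hadj b hab)
  exists_pos := hpos

omit [DecidableEq V] in
theorem area_le_sum (h : F.NonSaddle n a) {K' : TriComplex V} (hD : K'.IsDisc)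
    (hb : K'.boundaryEdges = F.complex.boundaryEdges)
    (hcard : K'.triangles.card ≤ F.complex.triangles.card) :
    F.area ≤ ∑ t ∈ K'.triangles, F.faceArea t :=
  h.minimizing.2 V ⟨K', hD, F.pos⟩ (sameBoundary_of_boundaryEdges_eq hb fun _ _ _ _ => rfl)
    (hcard.trans h.minimizing.1)

end NonSaddle

/-! ### The descent step -/

namespace FlipSite

variable {n : ℕ} {F : PolyhedralDisc V} {a x y z : V}

theorem card_axz (s : F.FlipSite a x y z) : ({a, x, z} : Finset V).card = 3 :=
  Finset.card_eq_three.2 ⟨a, x, z, s.hax, s.haz, s.hxz, rfl⟩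

theorem card_xyz (s : F.FlipSite a x y z) : ({x, y, z} : Finset V).card = 3 :=
  Finset.card_eq_three.2 ⟨x, y, z, s.hxy, s.hxz, s.hyz, rfl⟩

theorem isFlip (s : F.FlipSite a x y z) (hxz : ¬ F.complex.graph.Adj x z) :
    IsFlip F.complex (F.complex.flip a x y z s.card_axz s.card_xyz) a x y z where
  hax := s.hax
  hay := s.hay
  haz := s.haz
  hxy := s.hxy
  hxz := s.hxz
  hyz := s.hyz
  mem_axy := s.mem_axy
  mem_ayz := s.mem_ayz
  not_adj t ht hx hz := hxz ⟨s.hxz, t, ht, hx, hz⟩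
  eq_or_eq t ht ha hy := by
    have : t ∈ F.complex.triOn {a, y} :=
      mem_triOn.2 ⟨ht, by simp [Finset.insert_subset_iff, ha, hy]⟩
    simpa [s.triOn_eq] using this
  mem_iff t := by
    simp [TriComplex.flip]

/-- The triangles at `a` become fewer if `a x y` and `a y z` are replaced by `a x z`. -/
theorem card_filter_lt (s : F.FlipSite a x y z) {K' : TriComplex V}
    (h : ∀ t ∈ K'.triangles, a ∈ t → t = {a, x, z} ∨
      (t ∈ F.complex.triangles ∧ t ≠ {a, x, y} ∧ t ≠ {a, y, z})) :
    (K'.triangles.filter (a ∈ ·)).card < (F.complex.triangles.filter (a ∈ ·)).card := by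
  have h1 : {a, x, y} ∈ F.complex.triangles.filter (a ∈ ·) :=
    Finset.mem_filter.2 ⟨s.mem_axy, by simp⟩
  have h2 : {a, y, z} ∈ (F.complex.triangles.filter (a ∈ ·)).erase {a, x, y} :=
    Finset.mem_erase.2 ⟨s.axy_ne_ayz.symm, Finset.mem_filter.2 ⟨s.mem_ayz, by simp⟩⟩
  have hsub : K'.triangles.filter (a ∈ ·) ⊆ insert {a, x, z}
      (((F.complex.triangles.filter (a ∈ ·)).erase {a, x, y}).erase {a, y, z}) := by
    intro t ht
    rw [Finset.mem_filter] at ht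
    simp only [Finset.mem_insert, Finset.mem_erase, Finset.mem_filter]
    rcases h t ht.1 ht.2 with h | ⟨h, h', h''⟩
    · exact .inl h
    · exact .inr ⟨h'', h', h, ht.2⟩
  have h3 := (Finset.card_le_card hsub).trans (Finset.card_insert_le _ _)
  have h4 := Finset.card_pos.2 ⟨_, h2⟩
  rw [Finset.card_erase_of_mem h2] at h3
  rw [Finset.card_erase_of_mem h1] at h3 h4
  omega

theorem faceArea_axz_pos (s : F.FlipSite a x y z)
    (heq : F.faceArea {a, x, z} + F.faceArea {x, y, z} =
      F.faceArea {a, x, y} + F.faceArea {a, y, z}) {t : Finset V}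
    (ht : t = {a, x, y} ∨ t = {a, y, z}) (hpos : 0 < F.faceArea t) :
    0 < F.faceArea {a, x, z} := by
  refine lt_of_le_of_ne (F.faceArea_nonneg _) fun h0 => ?_
  have := s.area_eq_zero heq h0.symm
  rcases ht with rfl | rfl
  · exact hpos.ne' this.1
  · exact hpos.ne' this.2

/-- If `x` and `z` are not adjacent, the flip gives a non-saddle vertex of smaller degree. -/
theorem exists_nonSaddle_of_not_adj (s : F.FlipSite a x y z) (h : F.NonSaddle n a)
    (hxz : ¬ F.complex.graph.Adj x z) : ∃ G : PolyhedralDisc V, G.NonSaddle n a ∧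
      (G.complex.triangles.filter (a ∈ ·)).card < (F.complex.triangles.filter (a ∈ ·)).card := by
  have hf := s.isFlip hxz
  set K' := F.complex.flip a x y z s.card_axz s.card_xyz
  have hD := hf.isDisc F.isDisc
  have hb := hf.boundaryEdges_eq F.isDisc.isBorderedSurface
  have hle := h.area_le_sum hD hb hf.card_triangles.le
  have hs := hf.sum_eq F.faceArea
  have hs' := hf.sum_eq' F.faceArea
  have har := s.area_le
  have hdef : F.area = ∑ t ∈ F.complex.triangles, F.faceArea t := rfl
  -- Minimality excludes a strict decrease, so the flip preserves area and the equality case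
  -- applies.
  have heq : F.faceArea {a, x, z} + F.faceArea {x, y, z} =
      F.faceArea {a, x, y} + F.faceArea {a, y, z} := by linarith
  refine ⟨⟨K', hD, F.pos⟩, h.replace hD hb hf.card_triangles.le (by linarith) ?_ ?_, ?_⟩
  · intro b hab
    refine (hf.adj_or hab).resolve_right ?_
    rintro (⟨h1, -⟩ | ⟨h1, -⟩)
    exacts [s.hax h1, s.haz h1]
  · obtain ⟨t, ht, hat, hpos⟩ := h.exists_pos
    by_cases hy : y ∈ t
    · exact ⟨_, hf.axz_mem, by simp, s.faceArea_axz_pos heq (hf.eq_or_eq t ht hat hy) hpos⟩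
    · exact ⟨t, hf.mem_of_mem ht fun hn => hy hn.2, hat, hpos⟩
  · refine s.card_filter_lt fun t ht hat => ?_
    rcases (hf.mem_iff t).1 ht with rfl | rfl | ⟨ht, hn⟩
    · exact .inl rfl
    · simp [s.hax, s.hay, s.haz] at hat
    · refine .inr ⟨ht, ?_, ?_⟩ <;> rintro rfl <;> simp at hn

theorem sum_collapse {c : Finset V → ZMod 2} {t₀ : Finset V} (hc : F.complex.Fills c t₀) :
    ∑ t ∈ (F.complex.collapse c t₀ hc.card_eq_three).triangles, F.faceArea t =
      F.faceArea t₀ + ∑ t ∈ F.complex.triangles with c t = 0, F.faceArea t :=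
  Finset.sum_insert (hc.not_mem_filter F.isDisc.isBorderedSurface)

theorem card_collapse_le {c : Finset V → ZMod 2} {t₀ t : Finset V} (hc : F.complex.Fills c t₀)
    (ht : t ∈ F.complex.triangles) (h : c t ≠ 0) :
    (F.complex.collapse c t₀ hc.card_eq_three).triangles.card ≤ F.complex.triangles.card := by
  refine (Finset.card_insert_le _ _).trans (Finset.card_lt_card ?_)
  exact Finset.filter_ssubset.2 ⟨t, ht, h⟩

theorem add_le_sum_filter (s : F.FlipSite a x y z) {c : Finset V → ZMod 2}
    (h₁ : c {a, x, y} ≠ 0) (h₂ : c {a, y, z} ≠ 0) :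
    F.faceArea {a, x, y} + F.faceArea {a, y, z} ≤
      ∑ t ∈ F.complex.triangles with ¬ c t = 0, F.faceArea t := by
  rw [← Finset.sum_pair s.axy_ne_ayz]
  refine Finset.sum_le_sum_of_subset_of_nonneg ?_ fun t _ _ => F.faceArea_nonneg t
  simp [Finset.insert_subset_iff, s.mem_axy, s.mem_ayz, h₁, h₂]

/-- By minimality the area inside the triangle `t₀` is at most the area of `t₀`. -/
theorem faceArea_le_of_fills (s : F.FlipSite a x y z) (h : F.NonSaddle n a)
    {c : Finset V → ZMod 2} {t₀ : Finset V} (hc : F.complex.Fills c t₀) (h₁ : c {a, x, y} ≠ 0) :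
    ∑ t ∈ F.complex.triangles with ¬ c t = 0, F.faceArea t ≤ F.faceArea t₀ := by
  have hle := h.area_le_sum (hc.isDisc_collapse F.isDisc)
    (hc.boundaryEdges_collapse F.isDisc.isBorderedSurface) (card_collapse_le hc s.mem_axy h₁)
  rw [sum_collapse hc, area, ← Finset.sum_filter_add_sum_filter_not F.complex.triangles
    (fun t => c t = 0)] at hle
  linarith

theorem add_add_le_of_fills (s : F.FlipSite a x y z) (h : F.NonSaddle n a)
    {c : Finset V → ZMod 2} {t₀ t : Finset V} (hc : F.complex.Fills c t₀)
    (h₁ : c {a, x, y} ≠ 0) (h₂ : c {a, y, z} ≠ 0) (ht : t ∈ F.complex.triangles) (h₀ : c t ≠ 0)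
    (hne₁ : t ≠ {a, x, y}) (hne₂ : t ≠ {a, y, z}) :
    F.faceArea t + (F.faceArea {a, x, y} + F.faceArea {a, y, z}) ≤ F.faceArea t₀ := by
  refine le_trans ?_ (s.faceArea_le_of_fills h hc h₁)
  rw [← Finset.sum_pair s.axy_ne_ayz, ← Finset.sum_insert (by simp [hne₁, hne₂])]
  refine Finset.sum_le_sum_of_subset_of_nonneg ?_ fun t _ _ => F.faceArea_nonneg t
  simp [Finset.insert_subset_iff, s.mem_axy, s.mem_ayz, h₁, h₂, ht, h₀]

/-- The area of the removed chain is at most that of `a x z` by minimality, hence at most `a x z`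
plus `x y z`, hence at most the two old triangles, which belong to the chain. So equality holds
throughout, and every other removed triangle has area zero. -/
theorem exists_nonSaddle_of_fills (s : F.FlipSite a x y z) (h : F.NonSaddle n a)
    {c : Finset V → ZMod 2} (hc : F.complex.Fills c {a, x, z}) (h₁ : c {a, x, y} ≠ 0)
    (h₂ : c {a, y, z} ≠ 0) : ∃ G : PolyhedralDisc V, G.NonSaddle n a ∧
      (G.complex.triangles.filter (a ∈ ·)).card < (F.complex.triangles.filter (a ∈ ·)).card := by
  have hin := s.add_le_sum_filter h₁ h₂
  have hle := s.faceArea_le_of_fills h hc h₁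
  have har := s.area_le
  have hxyz := F.faceArea_nonneg {x, y, z}
  have heq : F.faceArea {a, x, z} + F.faceArea {x, y, z} =
      F.faceArea {a, x, y} + F.faceArea {a, y, z} := by linarith
  refine ⟨⟨F.complex.collapse c _ hc.card_eq_three, hc.isDisc_collapse F.isDisc, F.pos⟩,
    h.replace (hc.isDisc_collapse F.isDisc)
      (hc.boundaryEdges_collapse F.isDisc.isBorderedSurface) (card_collapse_le hc s.mem_axy h₁)
      ?_ (fun b hab => hc.adj_of_collapse_adj hab) ?_, ?_⟩
  · rw [sum_collapse hc, area, ← Finset.sum_filter_add_sum_filter_not F.complex.triangles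
      (fun t => c t = 0)]
    linarith
  · obtain ⟨t, ht, hat, hpos⟩ := h.exists_pos
    by_cases h₀ : c t = 0
    · exact ⟨t, mem_collapse.2 (.inr ⟨ht, h₀⟩), hat, hpos⟩
    · refine ⟨_, mem_collapse.2 (.inl rfl), by simp, s.faceArea_axz_pos heq ?_ hpos⟩
      by_contra! hne
      have := s.add_add_le_of_fills h hc h₁ h₂ ht h₀ hne.1 hne.2
      linarith
  · refine s.card_filter_lt fun t ht _ => ?_
    rcases (mem_collapse (h := hc.card_eq_three)).1 ht with rfl | ⟨ht, h₀⟩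
    · exact .inl rfl
    · refine .inr ⟨ht, ?_, ?_⟩ <;> rintro rfl <;> contradiction

/-- The same chain of inequalities gives `a x z` area zero, hence also the two old triangles. Since
`a` is not a vertex of `x y z`, the chain contains the whole star of `a`, including a third triangle
of positive area, which breaks the equality. -/
theorem false_of_fills (s : F.FlipSite a x y z) (h : F.NonSaddle n a)
    {c : Finset V → ZMod 2} (hc : F.complex.Fills c {x, y, z}) (h₁ : c {a, x, y} ≠ 0)
    (h₂ : c {a, y, z} ≠ 0) : False := by
  have hin := s.add_le_sum_filter h₁ h₂
  have hle := s.faceArea_le_of_fills h hc h₁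
  have har := s.area_le
  have haxz := F.faceArea_nonneg {a, x, z}
  have h0 := s.area_eq_zero (by linarith) (by linarith)
  obtain ⟨t, ht, hat, hpos⟩ := h.exists_pos
  have hct : c t ≠ 0 := by
    rwa [hc.eq_of_vertex F.isDisc.isBorderedSurface (v := a)
      (by simp [s.hax, s.hay, s.haz]) ht s.mem_axy hat (by simp)]
  by_cases hne₁ : t = {a, x, y}
  · rw [hne₁] at hpos
    exact hpos.ne' h0.1
  by_cases hne₂ : t = {a, y, z}
  · rw [hne₂] at hpos
    exact hpos.ne' h0.2
  have := s.add_add_le_of_fills h hc h₁ h₂ ht hct hne₁ hne₂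
  linarith

/-- A flip site at a non-saddle vertex gives a non-saddle vertex of smaller degree. -/
theorem exists_nonSaddle (s : F.FlipSite a x y z) (h : F.NonSaddle n a) :
    ∃ G : PolyhedralDisc V, G.NonSaddle n a ∧
      (G.complex.triangles.filter (a ∈ ·)).card < (F.complex.triangles.filter (a ∈ ·)).card := by
  by_cases hxz : F.complex.graph.Adj x z
  swap
  · exact s.exists_nonSaddle_of_not_adj h hxz
  have hK := F.isDisc.isBorderedSurface
  have edge : ∀ {t e : Finset V}, t ∈ F.complex.triangles → e.card = 2 → e ⊆ t →
      e ∈ F.complex.edges := fun ht h2 he => ⟨h2, _, ht, he⟩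
  have pair : ∀ (e : Finset V), e.card = 2 → e ⊆ {a, x, z} ∨ e ⊆ {x, y, z} →
      e = {x, z} ∨ e ⊆ {a, x, y} ∨ e ⊆ {a, y, z} := by
    intro e h2 he
    obtain ⟨u, v, huv, rfl⟩ := Finset.card_eq_two.1 h2
    simp only [Finset.insert_subset_iff, Finset.singleton_subset_iff, Finset.mem_insert,
      Finset.mem_singleton] at he ⊢
    have hc := Finset.pair_comm x z
    rcases he with ⟨rfl | rfl | rfl, rfl | rfl | rfl⟩ | ⟨rfl | rfl | rfl, rfl | rfl | rfl⟩ <;>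
      simp_all
  have hedges : ∀ e : Finset V, e.card = 2 → e ⊆ {a, x, z} ∨ e ⊆ {x, y, z} →
      e ∈ F.complex.edges := by
    intro e h2 he
    rcases pair e h2 he with rfl | he | he
    · exact pair_mem_edges.2 hxz
    · exact edge s.mem_axy h2 he
    · exact edge s.mem_ayz h2 he
  obtain ⟨c, hc⟩ := F.isDisc.exists_fills s.card_axz fun e he h2 => hedges e h2 (.inl he)
  -- The common edge `a y` is not a side of `a x z`, so the filling contains both triangles or
  -- neither.
  have hcc : c {a, x, y} = c {a, y, z} :=
    hc.eq_of_edge hK (e := {a, y}) (edge s.mem_axy (Finset.card_pair s.hay) (by grind))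
      (by simp [Finset.insert_subset_iff, s.hay.symm, s.hxy.symm, s.hyz])
      s.mem_axy s.mem_ayz (by grind) (by grind)
  by_cases h0 : c {a, x, y} = 0
  · exfalso
    -- If the filling of `a x z` contains neither triangle, adding both yields a filling of `x y z`,
    -- because the four faces of a tetrahedron sum to a closed chain.
    refine s.false_of_fills h (c := fun t => c t + ((if t = {a, x, y} then 1 else 0) +
      if t = {a, y, z} then 1 else 0)) ⟨s.card_xyz, fun e he h2 => hedges e h2 (.inr he), ?_⟩ ?_ ?_
    · intro e he
      rw [bd_add, bd_add, hc.bd_eq e he, bd_indicator _ _ s.mem_axy, bd_indicator _ _ s.mem_ayz,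
        ← tetrahedron_boundary s.hax s.hay s.haz s.hxy s.hxz s.hyz he.1, ← add_assoc,
        CharTwo.add_self_eq_zero, zero_add]
    · simp [h0, s.axy_ne_ayz]
    · simp [← hcc, h0, s.axy_ne_ayz.symm]
  · exact s.exists_nonSaddle_of_fills h hc h0 (hcc ▸ h0)

end FlipSite

/-- The descent needs no base case: every configuration produces a smaller one with the same `a` and
`n`. -/
theorem not_nonSaddle {n : ℕ} {F : PolyhedralDisc V} {a : V} : ¬ F.NonSaddle n a := by
  induction hd : (F.complex.triangles.filter (a ∈ ·)).card using Nat.strong_induction_on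
    generalizing F with
  | _ d ih =>
    intro h
    obtain ⟨x, y, z, s⟩ := h.exists_flipSite
    obtain ⟨G, hG, hlt⟩ := s.exists_nonSaddle h
    exact ih _ (hd ▸ hlt) rfl hG

end PolyhedralDisc

theorem mainTheorem1 {V : Type} (n : ℕ) (F : PolyhedralDisc V) (hF : F.IsAreaMinimizing n)
    (a : V) (ha : a ∈ F.complex.interiorVertices)
    (hnd : ∃ t ∈ F.complex.triangles, a ∈ t ∧ F.NondegenerateOn t) :
    F.IsSaddleAt a := by
  classical
  rintro ⟨u, c, -, hcut⟩
  refine PolyhedralDisc.not_nonSaddle (n := n) (F := F) (a := a) ⟨hF, ha, ?_, ?_⟩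
  -- The normal of the cutting plane, oriented away from the side of `a`, is the half-space
  -- direction.
  · by_cases hc : inner ℝ u (F.pos a) - c < 0
    · refine ⟨u, fun b hb => ?_⟩
      have := pos_of_mul_neg_right (hcut b hb) hc.le
      rw [inner_sub_right]
      linarith
    · refine ⟨-u, fun b hb => ?_⟩
      have := neg_of_mul_neg_right (hcut b hb) (not_lt.1 hc)
      rw [inner_neg_left, inner_sub_right]
      linarith
  · obtain ⟨t, ht, hat, h⟩ := hnd
    exact ⟨t, ht, hat,
      PolyhedralDisc.faceArea_pos_of_nondegenerateOn (F.complex.card_eq_three t ht) h⟩
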